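/- All systems are finite-dimensional with fixed orthonormal bases; a state is a positive semi-definite operator of trace one, a channel is a completely positive trace-preserving linear map, $T_S$ is the transpose on the systems $S$ (in the fixed basis), and $X\ge Y$ means that $X-Y$ is positive semi-definite. The Choi operator of a linear map $\mathcal N_{C\to D}$ is $\Gamma^{\mathcal N}_{RD}=(\mathrm{id}_R\otimes\mathcal N)(|\Gamma\rangle\langle\Gamma|_{RC})$ with $R\simeq C$ and $|\Gamma\rangle_{RC}=\sum_i|i\rangle_R|i\rangle_C$. The diamond distance of channels is $\|\mathcal N-\mathcal M\|_\diamond=\sup_{\omega_{RC}}\|(\mathrm{id}_R\otimes\mathcal N)(\omega_{RC})-(\mathrm{id}_R\otimes\mathcal M)(\omega_{RC})\|_1$, the supremum being over all reference systems $R$ and all states $\omega_{RC}$, where $\|X\|_1=\operatorname{Tr}\sqrt{X^\dagger X}$. A bipartite channel $\mathcal P_{AB\to A'B'}$ (Alice holds $A,A'$, Bob holds $B,B'$) is C-PPT-P if $T_{B'}\circ\mathcal P\circ T_B$ is completely positive. Let $\mathcal N_{AB\to A'B'}$ be an arbitrary bipartite channel and $\rho_{\hat A\hat B}$ a state. Define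 the simulation error $$e_{\mathrm{PPT}}(\mathcal N,\rho)=\frac12\inf_{\mathcal P\in\text{C-PPT-P}}\big\|\mathcal N-\widetilde{\mathcal N}^{\mathcal P}\big\|_\diamond,\qquad \widetilde{\mathcal N}^{\mathcal P}(\omega_{AB})=\mathcal P(\omega_{AB}\otimes\rho_{\hat A\hat B}),$$ the infimum being over C-PPT-P channels $\mathcal P_{A\hat A\,B\hat B\to A'B'}$ (Alice's input is $A\hat A$, Bob's is $B\hat B$). **(1)** $e_{\mathrm{PPT}}(\mathcal N,\rho)$ is the value of the semi-definite program $$\inf_{\mu\ge0,\ Z_{ABA'B'}\ge0,\ P_{AB\hat A\hat BA'B'}\ge0}\ \mu$$ subject to $$\mu I_{AB}\ge\operatorname{Tr}_{A'B'}[Z_{ABA'B'}],\qquad T_{B\hat BB'}(P_{AB\hat A\hat BA'B'})\ge0,\qquad \operatorname{Tr}_{A'B'}[P_{AB\hat A\hat BA'B'}]=I_{AB\hat A\hat B},$$ $$Z_{ABA'B'}\ge\Gamma^{\mathcal N}_{ABA'B'}-\operatorname{Tr}_{\hat A\hat B}\big[T_{\hat A\hat B}(\rho_{\hat A\hat B})\,P_{AB\hat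 A\hat BA'B'}\big].$$ **(2)** The dual of this semi-definite program is $$\sup\ \operatorname{Tr}[\Gamma^{\mathcal N}_{ABA'B'}X^2_{ABA'B'}]-\operatorname{Tr}[W_{AB\hat A\hat B}]$$ over $X^1_{AB}\ge0$, $X^2_{ABA'B'}\ge0$, $X^3_{AB\hat A\hat BA'B'}\ge0$ and Hermitian $W_{AB\hat A\hat B}$, subject to $$\operatorname{Tr}[X^1_{AB}]\le1,\qquad X^2_{ABA'B'}\le X^1_{AB}\otimes I_{A'B'},$$ $$X^2_{ABA'B'}\otimes T_{\hat A\hat B}(\rho_{\hat A\hat B})+T_{B\hat BB'}(X^3_{AB\hat A\hat BA'B'})\le W_{AB\hat A\hat B}\otimes I_{A'B'}.$$ Here the dual of a program $\inf_{Y\ge0}\{\operatorname{Tr}[BY]:\Phi(Y)\ge A\}$, with $A,B$ Hermitian and $\Phi$ a Hermiticity-preserving linear map, is $\sup_{X\ge0}\{\operatorname{Tr}[AX]:\Phi^\dagger(X)\le B\}$, with $\Phi^\dagger$ the Hilbert–Schmidt adjoint. Precisely: writing the program in (1) in this standard form with $$Y=\operatorname{diag}(\mu,Z,P),\quad B=\operatorname{diag}(1,0,0),\quad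 A=\operatorname{diag}(0,\Gamma^{\mathcal N},0,I_{AB\hat A\hat B},-I_{AB\hat A\hat B}),$$ $$\Phi(Y)=\operatorname{diag}\big(\mu I_{AB}-\operatorname{Tr}_{A'B'}Z,\ Z+\operatorname{Tr}_{\hat A\hat B}[T_{\hat A\hat B}(\rho)P],\ T_{B\hat BB'}(P),\ \operatorname{Tr}_{A'B'}P,\ -\operatorname{Tr}_{A'B'}P\big)$$ ($\Phi$ of a general block operator depends only on its diagonal blocks), $A$ and $B$ are Hermitian, $\Phi$ preserves Hermiticity, the feasible points of the standard form attain exactly the same objective values as those of the program in (1), and the feasible points of its dual attain exactly the same objective values as those of the explicit dual program above. -/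

import Mathlib

open Matrix
open scoped Kronecker ComplexOrder

noncomputable section

namespace QSim

/-- A quantum state: positive semidefinite with unit trace. -/
def IsState {c : Type*} [Fintype c] (ρ : Matrix c c ℂ) : Prop :=
  ρ.PosSemidef ∧ ρ.trace = 1

/-- The trace norm `‖X‖₁ = Tr √(X† X)`. -/
def traceNorm {c : Type*} [Fintype c] [DecidableEq c] (X : Matrix c c ℂ) : ℝ :=
  (cfc Real.sqrt (Xᴴ * X)).trace.re

/-- The ampliation `id_R ⊗ N`, acting block by block. -/
def ampl (r : Type*) {c d : Type*} (N : Matrix c c ℂ →ₗ[ℂ] Matrix d d ℂ) :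
    Matrix (r × c) (r × c) ℂ →ₗ[ℂ] Matrix (r × d) (r × d) ℂ where
  toFun X := of fun p q => N (of fun i j => X (p.1, i) (q.1, j)) p.2 q.2
  map_add' X Y := by
    ext p q
    exact congrFun (congrFun (N.map_add (of fun i j => X (p.1, i) (q.1, j))
      (of fun i j => Y (p.1, i) (q.1, j))) p.2) q.2
  map_smul' z X := by
    ext p q
    exact congrFun (congrFun (N.map_smul z (of fun i j => X (p.1, i) (q.1, j))) p.2) q.2

/-- Complete positivity: `id_R ⊗ N` is positive for every finite-dimensional reference `R`. -/
def IsCP {c d : Type*} (N : Matrix c c ℂ →ₗ[ℂ] Matrix d d ℂ) : Prop :=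
  ∀ (n : ℕ) (X : Matrix (Fin n × c) (Fin n × c) ℂ), X.PosSemidef → (ampl (Fin n) N X).PosSemidef

/-- A quantum channel: a completely positive, trace-preserving linear map. -/
def IsChannel {c d : Type*} [Fintype c] [Fintype d]
    (N : Matrix c c ℂ →ₗ[ℂ] Matrix d d ℂ) : Prop :=
  IsCP N ∧ ∀ X, (N X).trace = X.trace

/-- The unnormalized maximally entangled vector `|Γ⟩ = ∑ i, |i⟩|i⟩`. -/
def gammaVec (c : Type*) [DecidableEq c] : c × c → ℂ := fun p => if p.1 = p.2 then 1 else 0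

/-- The Choi operator `(id_R ⊗ N)(|Γ⟩⟨Γ|)`, with `R ≃ C`. -/
def choi {c d : Type*} [DecidableEq c] (N : Matrix c c ℂ →ₗ[ℂ] Matrix d d ℂ) :
    Matrix (c × d) (c × d) ℂ :=
  ampl c N (vecMulVec (gammaVec c) (star (gammaVec c)))

/-- The diamond distance: the supremum, over all finite-dimensional reference systems `R` and all
states of `RC`, of the trace distance of the outputs. -/
def diamondDist {c d : Type*} [Fintype c] [Fintype d] [DecidableEq d]
    (N M : Matrix c c ℂ →ₗ[ℂ] Matrix d d ℂ) : ℝ :=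
  sSup {x : ℝ | ∃ (n : ℕ) (ρ : Matrix (Fin n × c) (Fin n × c) ℂ), IsState ρ ∧
    x = traceNorm (ampl (Fin n) N ρ - ampl (Fin n) M ρ)}

/-- Partial transpose on the second tensor factor. -/
def transposeRight (a b : Type*) :
    Matrix (a × b) (a × b) ℂ →ₗ[ℂ] Matrix (a × b) (a × b) ℂ where
  toFun X := of fun p q => X (p.1, q.2) (q.1, p.2)
  map_add' _ _ := by ext; simp
  map_smul' _ _ := by ext; simp

/-- A bipartite map `P : AB → A'B'` is a C-PPT-P channel if it is a channel and
`T_{B'} ∘ P ∘ T_B` is completely positive. -/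
def IsCPPTP {a b a' b' : Type*} [Fintype a] [Fintype b] [Fintype a'] [Fintype b']
    (P : Matrix (a × b) (a × b) ℂ →ₗ[ℂ] Matrix (a' × b') (a' × b') ℂ) : Prop :=
  IsChannel P ∧ IsCP (transposeRight a' b' ∘ₗ P ∘ₗ transposeRight a b)

/-- The operator `ω_{AB} ⊗ ρ_{ÂB̂}`, its systems ordered as `(A Â)(B B̂)` (Alice's first). -/
def attach {a b ah bh : Type*} (ρ : Matrix (ah × bh) (ah × bh) ℂ) :
    Matrix (a × b) (a × b) ℂ →ₗ[ℂ] Matrix ((a × ah) × (b × bh)) ((a × ah) × (b × bh)) ℂ where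
  toFun ω := (ω ⊗ₖ ρ).submatrix
    (fun p => ((p.1.1, p.2.1), (p.1.2, p.2.2))) (fun p => ((p.1.1, p.2.1), (p.1.2, p.2.2)))
  map_add' _ _ := by ext; simp [add_mul]
  map_smul' _ _ := by ext; simp [mul_assoc]

/-- The simulation `ω_{AB} ↦ P(ω_{AB} ⊗ ρ_{ÂB̂})`; Alice's input of `P` is `AÂ`, Bob's is `BB̂`. -/
def simulation {a b ah bh a' b' : Type*} (ρ : Matrix (ah × bh) (ah × bh) ℂ)
    (P : Matrix ((a × ah) × (b × bh)) ((a × ah) × (b × bh)) ℂ →ₗ[ℂ]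
      Matrix (a' × b') (a' × b') ℂ) :
    Matrix (a × b) (a × b) ℂ →ₗ[ℂ] Matrix (a' × b') (a' × b') ℂ :=
  P ∘ₗ attach ρ

/-- Partial trace over the second factor. -/
def traceRight (m n : Type*) [Fintype n] : Matrix (m × n) (m × n) ℂ →ₗ[ℂ] Matrix m m ℂ where
  toFun X := of fun i j => ∑ k, X (i, k) (j, k)
  map_add' _ _ := by ext; simp [Finset.sum_add_distrib]
  map_smul' _ _ := by ext; simp [Finset.mul_sum]

/-- Partial trace over the middle factor. -/
def traceMid (m k n : Type*) [Fintype k] :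
    Matrix ((m × k) × n) ((m × k) × n) ℂ →ₗ[ℂ] Matrix (m × n) (m × n) ℂ where
  toFun X := of fun p q => ∑ x, X ((p.1, x), p.2) ((q.1, x), q.2)
  map_add' _ _ := by ext; simp [Finset.sum_add_distrib]
  map_smul' _ _ := by ext; simp [Finset.mul_sum]

/-- The map `P ↦ Tr_{ÂB̂}[T_{ÂB̂}(ρ_{ÂB̂}) P]`. -/
def contract {k : Type*} [Fintype k] (m n : Type*) [Fintype m] [Fintype n]
    [DecidableEq m] [DecidableEq n] (ρ : Matrix k k ℂ) :
    Matrix ((m × k) × n) ((m × k) × n) ℂ →ₗ[ℂ] Matrix (m × n) (m × n) ℂ :=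
  traceMid m k n ∘ₗ LinearMap.mulLeft ℂ (((1 : Matrix m m ℂ) ⊗ₖ ρᵀ) ⊗ₖ (1 : Matrix n n ℂ))

/-- The operator `X_{mn} ⊗ σ_k`, its systems ordered as `(m k) n`. -/
def insertMid {m k n : Type*} (X : Matrix (m × n) (m × n) ℂ) (σ : Matrix k k ℂ) :
    Matrix ((m × k) × n) ((m × k) × n) ℂ :=
  (X ⊗ₖ σ).submatrix (fun p => ((p.1.1, p.2), p.1.2)) (fun p => ((p.1.1, p.2), p.1.2))

/-- The partial transpose `T_{B B̂ B'}` on operators of the systems `(AB)(ÂB̂)(A'B')`. -/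
def transposeBob (a b ah bh a' b' : Type*) :
    Matrix (((a × b) × (ah × bh)) × (a' × b')) (((a × b) × (ah × bh)) × (a' × b')) ℂ →ₗ[ℂ]
      Matrix (((a × b) × (ah × bh)) × (a' × b')) (((a × b) × (ah × bh)) × (a' × b')) ℂ where
  toFun X := of fun p q =>
    X (((p.1.1.1, q.1.1.2), (p.1.2.1, q.1.2.2)), (p.2.1, q.2.2))
      (((q.1.1.1, p.1.1.2), (q.1.2.1, p.1.2.2)), (q.2.1, p.2.2))
  map_add' _ _ := by ext; simp
  map_smul' _ _ := by ext; simp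

/-! ### Semidefinite programs in standard form -/

/-- Data of the semidefinite program `inf_{Y ≥ 0} {Tr[BY] : Φ(Y) ≥ A}`. -/
structure SDP (n m : Type*) where
  A : Matrix m m ℂ
  B : Matrix n n ℂ
  Φ : Matrix n n ℂ →ₗ[ℂ] Matrix m m ℂ

namespace SDP

variable {n m : Type*} [Fintype n] [Fintype m]

/-- `A` and `B` are Hermitian and `Φ` preserves Hermiticity. -/
def IsHermitian {n m : Type*} (S : SDP n m) : Prop :=
  S.A.IsHermitian ∧ S.B.IsHermitian ∧ ∀ Y : Matrix n n ℂ, Y.IsHermitian → (S.Φ Y).IsHermitian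

open Classical in
/-- The Hilbert-Schmidt adjoint of a linear map on matrices. -/
def adjoint (Φ : Matrix n n ℂ →ₗ[ℂ] Matrix m m ℂ) (X : Matrix m m ℂ) : Matrix n n ℂ :=
  of fun i j => ((Φ (Matrix.single i j 1))ᴴ * X).trace

/-- The defining property of the adjoint. -/
theorem trace_adjoint (Φ : Matrix n n ℂ →ₗ[ℂ] Matrix m m ℂ) (X : Matrix m m ℂ)
    (Y : Matrix n n ℂ) : (Yᴴ * adjoint Φ X).trace = ((Φ Y)ᴴ * X).trace := by
  classical
  have key : ∀ Y : Matrix n n ℂ, Φ Y = ∑ i, ∑ j, Y i j • Φ (Matrix.single i j 1) := by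
    intro Y
    conv_lhs => rw [Matrix.matrix_eq_sum_single Y]
    simp only [map_sum]
    refine Finset.sum_congr rfl fun i _ => Finset.sum_congr rfl fun j _ => ?_
    rw [← map_smul, Matrix.smul_single, smul_eq_mul, mul_one]
  rw [key Y]
  simp only [conjTranspose_sum, conjTranspose_smul, Finset.sum_mul, trace_sum, smul_mul_assoc,
    trace_smul]
  simp only [Matrix.trace, Matrix.diag, Matrix.mul_apply, adjoint, of_apply, conjTranspose_apply,
    smul_eq_mul]
  rw [Finset.sum_comm]

/-- Objective values of the feasible points of `inf_{Y ≥ 0} {Tr[BY] : Φ(Y) ≥ A}`. -/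
def primalValues (S : SDP n m) : Set ℝ :=
  {v | ∃ Y : Matrix n n ℂ, Y.PosSemidef ∧ (S.Φ Y - S.A).PosSemidef ∧ v = (S.B * Y).trace.re}

/-- Objective values of the feasible points of the dual program
`sup_{X ≥ 0} {Tr[AX] : Φ†(X) ≤ B}`. -/
def dualValues (S : SDP n m) : Set ℝ :=
  {v | ∃ X : Matrix m m ℂ, X.PosSemidef ∧ (S.B - adjoint S.Φ X).PosSemidef ∧
    v = (S.A * X).trace.re}

end SDP

/-! ### The simulation error and its semidefinite programs -/

section Programs

variable {a b ah bh a' b' : Type*} [Fintype a] [Fintype b] [Fintype ah] [Fintype bh]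
  [Fintype a'] [Fintype b'] [DecidableEq a] [DecidableEq b] [DecidableEq ah] [DecidableEq bh]
  [DecidableEq a'] [DecidableEq b']

/-- The simulation error `e_PPT(N, ρ)` under C-PPT-P channels, in normalized diamond distance. -/
def errPPT (N : Matrix (a × b) (a × b) ℂ →ₗ[ℂ] Matrix (a' × b') (a' × b') ℂ)
    (ρ : Matrix (ah × bh) (ah × bh) ℂ) : ℝ :=
  (1 / 2) * sInf {x : ℝ | ∃ P : Matrix ((a × ah) × (b × bh)) ((a × ah) × (b × bh)) ℂ →ₗ[ℂ]
    Matrix (a' × b') (a' × b') ℂ, IsCPPTP P ∧ x = diamondDist N (simulation ρ P)}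

/-- Objective values `μ` of the feasible points of the primal program. -/
def simPrimalValues (N : Matrix (a × b) (a × b) ℂ →ₗ[ℂ] Matrix (a' × b') (a' × b') ℂ)
    (ρ : Matrix (ah × bh) (ah × bh) ℂ) : Set ℝ :=
  {μ | ∃ (Z : Matrix ((a × b) × (a' × b')) ((a × b) × (a' × b')) ℂ)
      (P : Matrix (((a × b) × (ah × bh)) × (a' × b')) (((a × b) × (ah × bh)) × (a' × b')) ℂ),
    0 ≤ μ ∧ Z.PosSemidef ∧ P.PosSemidef ∧
    ((μ : ℂ) • (1 : Matrix (a × b) (a × b) ℂ) - traceRight (a × b) (a' × b') Z).PosSemidef ∧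
    (transposeBob a b ah bh a' b' P).PosSemidef ∧
    traceRight ((a × b) × (ah × bh)) (a' × b') P = 1 ∧
    (Z - (choi N - contract (a × b) (a' × b') ρ P)).PosSemidef}

/-- Objective values of the feasible points of the explicit dual program. -/
def simDualValues (N : Matrix (a × b) (a × b) ℂ →ₗ[ℂ] Matrix (a' × b') (a' × b') ℂ)
    (ρ : Matrix (ah × bh) (ah × bh) ℂ) : Set ℝ :=
  {v | ∃ (X₁ : Matrix (a × b) (a × b) ℂ)
      (X₂ : Matrix ((a × b) × (a' × b')) ((a × b) × (a' × b')) ℂ)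
      (X₃ : Matrix (((a × b) × (ah × bh)) × (a' × b')) (((a × b) × (ah × bh)) × (a' × b')) ℂ)
      (W : Matrix ((a × b) × (ah × bh)) ((a × b) × (ah × bh)) ℂ),
    X₁.PosSemidef ∧ X₂.PosSemidef ∧ X₃.PosSemidef ∧ W.IsHermitian ∧
    X₁.trace.re ≤ 1 ∧
    (X₁ ⊗ₖ (1 : Matrix (a' × b') (a' × b') ℂ) - X₂).PosSemidef ∧
    (W ⊗ₖ (1 : Matrix (a' × b') (a' × b') ℂ)
      - (insertMid X₂ ρᵀ + transposeBob a b ah bh a' b' X₃)).PosSemidef ∧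
    v = (choi N * X₂).trace.re - W.trace.re}

/-- Block-diagonal matrix with the two given blocks. -/
def diag₂ {p q : Type*} (X : Matrix p p ℂ) (Y : Matrix q q ℂ) : Matrix (p ⊕ q) (p ⊕ q) ℂ :=
  fromBlocks X 0 0 Y

/-- The primal program in standard form. The variable is `Y = diag(μ, Z, P)`, and
`B = diag(1, 0, 0)`, `A = diag(0, Γ^N, 0, I, -I)`,
`Φ(Y) = diag(μ I - Tr_{A'B'} Z, Z + Tr_{ÂB̂}[T(ρ) P], T_{BB̂B'} P, Tr_{A'B'} P, -Tr_{A'B'} P)`;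
the equality constraint on `P` is written as two inequalities. -/
def simSDP (N : Matrix (a × b) (a × b) ℂ →ₗ[ℂ] Matrix (a' × b') (a' × b') ℂ)
    (ρ : Matrix (ah × bh) (ah × bh) ℂ) :
    SDP (Unit ⊕ (((a × b) × (a' × b')) ⊕ (((a × b) × (ah × bh)) × (a' × b'))))
      ((a × b) ⊕ (((a × b) × (a' × b')) ⊕ ((((a × b) × (ah × bh)) × (a' × b')) ⊕
        (((a × b) × (ah × bh)) ⊕ ((a × b) × (ah × bh)))))) where
  A := diag₂ 0 (diag₂ (choi N) (diag₂ 0 (diag₂ 1 (-1))))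
  B := diag₂ 1 (diag₂ 0 0)
  Φ :=
    { toFun := fun Y =>
        let μ : ℂ := Y (Sum.inl ()) (Sum.inl ())
        let Z := Y.toBlocks₂₂.toBlocks₁₁
        let P := Y.toBlocks₂₂.toBlocks₂₂
        diag₂ (μ • 1 - traceRight (a × b) (a' × b') Z)
          (diag₂ (Z + contract (a × b) (a' × b') ρ P)
            (diag₂ (transposeBob a b ah bh a' b' P)
              (diag₂ (traceRight ((a × b) × (ah × bh)) (a' × b') P)
                (-traceRight ((a × b) × (ah × bh)) (a' × b') P))))
      map_add' := by
        intro X Y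
        have h₁ : (X + Y).toBlocks₂₂.toBlocks₁₁
            = X.toBlocks₂₂.toBlocks₁₁ + Y.toBlocks₂₂.toBlocks₁₁ := rfl
        have h₂ : (X + Y).toBlocks₂₂.toBlocks₂₂
            = X.toBlocks₂₂.toBlocks₂₂ + Y.toBlocks₂₂.toBlocks₂₂ := rfl
        simp only [diag₂, h₁, h₂, map_add, Matrix.add_apply, fromBlocks_add, add_zero, add_smul]
        congr 1
        · abel
        · congr 1
          · abel
          · congr 2
            abel
      map_smul' := by
        intro z X
        have h₁ : (z • X).toBlocks₂₂.toBlocks₁₁ = z • X.toBlocks₂₂.toBlocks₁₁ := rfl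
        have h₂ : (z • X).toBlocks₂₂.toBlocks₂₂ = z • X.toBlocks₂₂.toBlocks₂₂ := rfl
        simp only [diag₂, h₁, h₂, map_smul, Matrix.smul_apply, fromBlocks_smul, smul_zero,
          smul_sub, smul_add, smul_neg, smul_smul, smul_eq_mul, RingHom.id_apply] }

end Programs

end QSim

end

/-! The proof works with Choi operators. The central fact is that, for channels N and M, half the
diamond distance is the infimum of the μ for which some Z ≥ 0 satisfies Z ≥ Γ^N − Γ^M and Tr_D Z ≤ μ
I.

A feasible Z is an upper bound (`diamondDist_le`): contracting with a state preserves positivity, so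
Z yields a positive operator of trace at most μ above the difference of the outputs. That difference
is traceless, so its trace norm is at most 2μ.

Conversely, let σ be a full-rank state, σ = S†S. On the pure input with coefficient matrix S the
output difference is (S⊗1)(Γ^N − Γ^M)(S⊗1)†; its positive part, pulled back by S⁻¹, is a Z with 2
Tr[σ Tr_D Z] at most the diamond distance (`exists_feasible_of_posDef`). Mixing in the maximally
mixed state extends this to all states with arbitrarily small loss, and Sion's minimax theorem gives
one Z good for every σ (`exists_feasible`).

The C-PPT-P conditions are linear constraints on the Choi operator (`isCPPTP_iff`), and inserting ρ
contracts it with the transpose of ρ (`choi_simulation`). Minimizing jointly over Z and P gives part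
(1).

For part (2) the adjoint is computed block by block (`simSDP_adjoint`). The equality constraint,
split into two inequalities, has two positive multipliers; their difference is the free Hermitian W.
-/

open Matrix
open scoped Kronecker ComplexOrder

noncomputable section

namespace QSim

set_option linter.unusedSectionVars false

/-! ### Trace norm of traceless Hermitian matrices through positive majorants. -/

section TraceNorm

variable {c : Type*} [Fintype c]

/-- The trace of a product of two positive semidefinite matrices is nonnegative. -/
theorem trace_mul_nonneg {A B : Matrix c c ℂ} (hA : A.PosSemidef) (hB : B.PosSemidef) :
    0 ≤ (A * B).trace := by
  classical
  open scoped MatrixOrder in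
  obtain ⟨C, rfl⟩ := CStarAlgebra.nonneg_iff_eq_star_mul_self.mp hA.nonneg
  rw [star_eq_conjTranspose, Matrix.trace_mul_cycle, Matrix.trace_mul_cycle]
  exact (hB.mul_mul_conjTranspose_same C).trace_nonneg

open scoped MatrixOrder in
theorem traceNorm_eq_trace_abs [DecidableEq c] (X : Matrix c c ℂ) :
    traceNorm X = (CFC.abs X).trace.re := by
  rw [traceNorm, CFC.abs, CFC.sqrt_eq_real_sqrt _ (star_mul_self_nonneg X), cfcₙ_eq_cfc]
  rfl

open scoped MatrixOrder in
/-- A traceless Hermitian matrix `X` has a positive part whose trace is `‖X‖₁ / 2`. -/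
theorem exists_posSemidef_trace_eq [DecidableEq c] {X : Matrix c c ℂ} (hX : X.IsHermitian)
    (htr : X.trace = 0) :
    ∃ P : Matrix c c ℂ, P.PosSemidef ∧ (P - X).PosSemidef ∧ 2 * P.trace.re = traceNorm X := by
  have hs : IsSelfAdjoint X := hX
  have h1 := CFC.posPart_sub_negPart X hs
  have h2 := CFC.posPart_add_negPart X hs
  refine ⟨X⁺, (CFC.posPart_nonneg X).posSemidef, ?_, ?_⟩
  · have : X⁺ - X = X⁻ := by nth_rewrite 2 [← h1]; abel
    rw [this]; exact (CFC.negPart_nonneg X).posSemidef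
  · rw [traceNorm_eq_trace_abs, ← h2]
    rw [← h1, trace_sub, sub_eq_zero] at htr
    rw [trace_add, ← htr, Complex.add_re]; ring

open scoped MatrixOrder in
/-- The trace norm of a difference of positive semidefinite matrices is at most the sum of their
traces. -/
theorem traceNorm_sub_le [DecidableEq c] {P Q : Matrix c c ℂ} (hP : P.PosSemidef)
    (hQ : Q.PosSemidef) : traceNorm (P - Q) ≤ P.trace.re + Q.trace.re := by
  set X := P - Q with hXdef
  have hs : IsSelfAdjoint X := hP.1.sub hQ.1
  -- The spectrum is finite, so even the discontinuous sign function is admissible in the functional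
  -- calculus.
  have hc : ∀ f : ℝ → ℝ, ContinuousOn f (spectrum ℝ X) := fun f =>
    (Matrix.finite_real_spectrum (A := X)).continuousOn f
  -- U is the sign of X, so ‖X‖₁ = Tr[U(P − Q)], and −1 ≤ U ≤ 1 bounds the two terms separately.
  set U : Matrix c c ℂ := cfc (fun x : ℝ => if 0 ≤ x then (1 : ℝ) else -1) X
  have hUX : U * X = CFC.abs X := by
    rw [CFC.abs_eq_cfc_norm X hs]
    have h : U * X = U * cfc (fun x : ℝ => x) X := by rw [cfc_id' ℝ X hs]
    rw [h, ← cfc_mul _ _ X (hc _) (hc _)]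
    refine cfc_congr fun x _ => ?_
    simp only [Real.norm_eq_abs]
    split_ifs with h
    · rw [abs_of_nonneg h, one_mul]
    · rw [abs_of_neg (not_le.1 h), neg_one_mul]
  have hU1 : (1 - U).PosSemidef := by
    have : (1 : Matrix c c ℂ) - U = cfc (fun x : ℝ => 1 - (if 0 ≤ x then (1 : ℝ) else -1)) X := by
      rw [cfc_sub _ _ X (hc _) (hc _), cfc_const_one ℝ X]
    rw [this]
    exact (cfc_nonneg fun x _ => by split_ifs <;> norm_num).posSemidef
  have hU2 : (1 + U).PosSemidef := by
    have : (1 : Matrix c c ℂ) + U = cfc (fun x : ℝ => 1 + (if 0 ≤ x then (1 : ℝ) else -1)) X := by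
      rw [cfc_add X _ _ (hc _) (hc _), cfc_const_one ℝ X]
    rw [this]
    exact (cfc_nonneg fun x _ => by split_ifs <;> norm_num).posSemidef
  have e1 := (Complex.le_def.1 (trace_mul_nonneg hU1 hP)).1
  have e2 := (Complex.le_def.1 (trace_mul_nonneg hU2 hQ)).1
  rw [traceNorm_eq_trace_abs, ← hUX, hXdef]
  simp only [sub_mul, add_mul, mul_sub, one_mul, trace_add, trace_sub, Complex.zero_re,
    Complex.add_re, Complex.sub_re] at e1 e2 ⊢
  linarith

/-- If `X` is traceless and dominated by a positive semidefinite `P`, then `‖X‖₁ ≤ 2 Tr P`. -/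
theorem traceNorm_le_of_posSemidef_sub [DecidableEq c] {X P : Matrix c c ℂ} (htr : X.trace = 0)
    (hP : P.PosSemidef) (hPX : (P - X).PosSemidef) : traceNorm X ≤ 2 * P.trace.re := by
  have h := traceNorm_sub_le hP hPX
  rw [sub_sub_cancel, trace_sub, htr, sub_zero] at h
  linarith

end TraceNorm

/-! ### The set of states is convex and compact. -/

section States

variable {c : Type*} [Fintype c]

theorem IsState.nonempty {ρ : Matrix c c ℂ} (hρ : IsState ρ) : Nonempty c := by
  by_contra h
  rw [not_nonempty_iff] at h
  have := hρ.2
  simp [Matrix.trace] at this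

theorem convex_isState : Convex ℝ {σ : Matrix c c ℂ | IsState σ} := by
  rintro σ ⟨h1, h2⟩ τ ⟨h3, h4⟩ s t hs ht hst
  refine ⟨(h1.smul hs).add (h3.smul ht), ?_⟩
  rw [trace_add, trace_smul, trace_smul, h2, h4, ← add_smul, hst, one_smul]

/-- The 2 × 2 principal minors give |σ i j|² ≤ σ i i · σ j j, and diagonal entries are nonnegative
with sum 1. This is the boundedness half of compactness. -/
theorem norm_entry_le_one {σ : Matrix c c ℂ} (hσ : IsState σ) (i j : c) : ‖σ i j‖ ≤ 1 := by
  have hd : ∀ k, 0 ≤ (σ k k).re ∧ (σ k k).im = 0 := fun k => by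
    have := Complex.le_def.1 (hσ.1.diag_nonneg (i := k))
    exact ⟨this.1, this.2.symm⟩
  have hle : ∀ k, (σ k k).re ≤ 1 := fun k => by
    have h1 : (∑ l, (σ l l).re) = 1 := by
      have := congrArg Complex.re hσ.2
      simpa [Matrix.trace] using this
    rw [← h1]
    exact Finset.single_le_sum (f := fun l => (σ l l).re) (fun l _ => (hd l).1) (Finset.mem_univ k)
  have hdet := (hσ.1.submatrix ![i, j]).det_nonneg
  rw [det_fin_two] at hdet
  have hji : σ j i = star (σ i j) := (hσ.1.1.apply j i).symm
  simp only [submatrix_apply, Matrix.cons_val_zero, Matrix.cons_val_one] at hdet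
  rw [hji] at hdet
  have h0 := (Complex.le_def.1 hdet).1
  have h5 : (σ i j * star (σ i j)).re = ‖σ i j‖ ^ 2 := by
    rw [Complex.star_def, Complex.mul_conj, Complex.ofReal_re, Complex.normSq_eq_norm_sq]
  rw [Complex.sub_re, h5, Complex.mul_re, (hd i).2, zero_mul, sub_zero, Complex.zero_re] at h0
  have := mul_le_mul (hle i) (hle j) (hd j).1 zero_le_one
  nlinarith [norm_nonneg (σ i j)]

open scoped MatrixOrder Matrix.Norms.L2Operator in
theorem isCompact_isState : IsCompact {σ : Matrix c c ℂ | IsState σ} := by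
  classical
  have hK : IsCompact {σ : Matrix c c ℂ | ∀ i j, σ i j ∈ Metric.closedBall (0 : ℂ) 1} := by
    have := isCompact_univ_pi fun _ : c => isCompact_univ_pi fun _ : c =>
      isCompact_closedBall (0 : ℂ) 1
    refine (congrArg IsCompact (Set.ext fun σ => ?_)).mp this
    exact ⟨fun h i j => h i trivial j trivial, fun h i _ j _ => h i j⟩
  refine hK.of_isClosed_subset ?_ fun σ hσ i j => by simpa using norm_entry_le_one hσ i j
  refine IsClosed.inter ?_ (isClosed_eq (by fun_prop) continuous_const)
  have : {σ : Matrix c c ℂ | σ.PosSemidef} = {σ | 0 ≤ σ} := by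
    ext; exact nonneg_iff_posSemidef.symm
  change IsClosed {σ : Matrix c c ℂ | σ.PosSemidef}
  rw [this]
  exact CStarAlgebra.isClosed_nonneg

end States

/-! ### Choi operators and their contraction with operators on RC. -/

section Choi

variable {c d : Type*} [Fintype c]

/-- The contraction of an operator on `RC` with a Choi operator on `CD`, an operator on `RD`. -/
def link {r c d : Type*} [Fintype c] (Z : Matrix (c × d) (c × d) ℂ)
    (X : Matrix (r × c) (r × c) ℂ) : Matrix (r × d) (r × d) ℂ :=
  of fun p q => ∑ i, ∑ j, X (p.1, i) (q.1, j) * Z (i, p.2) (j, q.2)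

theorem link_sub {r : Type*} (Z W : Matrix (c × d) (c × d) ℂ) (X : Matrix (r × c) (r × c) ℂ) :
    link (Z - W) X = link Z X - link W X := by
  ext; simp [link, mul_sub, Finset.sum_sub_distrib]

/-- The contraction is a compression Vᴴ (X ⊗ Z) V, where V identifies the two copies of `c` and sums
over them. -/
theorem link_posSemidef {r : Type*} [Fintype r] [Fintype d] {Z : Matrix (c × d) (c × d) ℂ}
    {X : Matrix (r × c) (r × c) ℂ} (hZ : Z.PosSemidef) (hX : X.PosSemidef) :
    (link Z X).PosSemidef := by
  classical
  have h := ((hX.kronecker hZ).submatrix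
    (fun p : c × (r × d) => ((p.2.1, p.1), (p.1, p.2.2)))).conjTranspose_mul_mul_same
    (of fun p q => if p.2 = q then (1 : ℂ) else 0 : Matrix (c × (r × d)) (r × d) ℂ)
  refine (congrArg PosSemidef ?_).mp h
  ext ⟨r, u⟩ ⟨s, v⟩
  simp only [link, of_apply, Matrix.mul_apply, conjTranspose_apply, Fintype.sum_prod_type,
    submatrix_apply, kroneckerMap_apply, apply_ite (star : ℂ → ℂ), star_one, star_zero,
    ite_mul, mul_ite, one_mul, zero_mul, mul_one, mul_zero,
    Finset.sum_ite_eq', Finset.mem_univ, if_true]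
  exact Finset.sum_comm

theorem trace_link {r : Type*} [Fintype r] [Fintype d] (Z : Matrix (c × d) (c × d) ℂ)
    (X : Matrix (r × c) (r × c) ℂ) :
    (link Z X).trace
      = ∑ k, (X.submatrix (Prod.mk k) (Prod.mk k) * (traceRight c d Z)ᵀ).trace := by
  simp only [Matrix.trace, Matrix.diag, link, of_apply, Fintype.sum_prod_type, Matrix.mul_apply,
    traceRight, transpose_apply, submatrix_apply, LinearMap.coe_mk, AddHom.coe_mk, Finset.mul_sum]
  refine Finset.sum_congr rfl fun k _ => ?_
  rw [Finset.sum_comm]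
  refine Finset.sum_congr rfl fun i _ => ?_
  rw [Finset.sum_comm]

/-- If `Tr_D Z ≤ μ` then the contraction with `Z` scales traces by at most `μ`. -/
theorem re_trace_link_le {r : Type*} [Fintype r] [Fintype d] [DecidableEq c] {μ : ℝ}
    {Z : Matrix (c × d) (c × d) ℂ}
    (hZ : ((μ : ℂ) • (1 : Matrix c c ℂ) - traceRight c d Z).PosSemidef)
    {X : Matrix (r × c) (r × c) ℂ} (hX : X.PosSemidef) :
    (link Z X).trace.re ≤ μ * X.trace.re := by
  have h : ∀ k, 0 ≤ (X.submatrix (Prod.mk k) (Prod.mk k) *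
      ((μ : ℂ) • (1 : Matrix c c ℂ) - traceRight c d Z)ᵀ).trace.re := fun k =>
    (Complex.le_def.1 (trace_mul_nonneg (hX.submatrix _) hZ.transpose)).1
  have htr : X.trace = ∑ k, (X.submatrix (Prod.mk k) (Prod.mk k)).trace := by
    simp [Matrix.trace, Fintype.sum_prod_type]
  rw [trace_link, htr, Complex.re_sum, Complex.re_sum, Finset.mul_sum]
  refine Finset.sum_le_sum fun k _ => ?_
  have := h k
  simp only [transpose_sub, transpose_smul, transpose_one, mul_sub, mul_smul_comm, mul_one,
    trace_sub, trace_smul, smul_eq_mul, Complex.sub_re, Complex.re_ofReal_mul] at this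
  linarith

variable [DecidableEq c]

theorem choi_apply {c : Type*} [DecidableEq c] (N : Matrix c c ℂ →ₗ[ℂ] Matrix d d ℂ)
    (p q : c × d) :
    choi N p q = N (single p.1 q.1 1) p.2 q.2 := by
  have : (of fun i j => vecMulVec (gammaVec c) (star (gammaVec c)) (p.1, i) (q.1, j))
      = single p.1 q.1 (1 : ℂ) := by
    ext i j
    simp only [vecMulVec_apply, gammaVec, single_apply, of_apply, Pi.star_apply]
    split_ifs <;> simp_all
  simp only [choi, ampl, LinearMap.coe_mk, AddHom.coe_mk, of_apply, this]

theorem apply_eq_sum_choi (N : Matrix c c ℂ →ₗ[ℂ] Matrix d d ℂ) (X : Matrix c c ℂ) (p q : d) :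
    N X p q = ∑ i, ∑ j, X i j * choi N (i, p) (j, q) := by
  conv_lhs => rw [Matrix.matrix_eq_sum_single X]
  simp only [map_sum, Matrix.sum_apply, choi_apply]
  refine Finset.sum_congr rfl fun i _ => Finset.sum_congr rfl fun j _ => ?_
  rw [← smul_eq_mul, ← Matrix.smul_apply, ← map_smul, smul_single, smul_eq_mul, mul_one]

theorem ampl_eq_link {r : Type*} (N : Matrix c c ℂ →ₗ[ℂ] Matrix d d ℂ)
    (X : Matrix (r × c) (r × c) ℂ) : ampl r N X = link (choi N) X := by
  ext p q
  simp [ampl, link, apply_eq_sum_choi N]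

/-- The linear map with the given Choi operator. -/
def ofChoi {c d : Type*} [Fintype c] (Z : Matrix (c × d) (c × d) ℂ) :
    Matrix c c ℂ →ₗ[ℂ] Matrix d d ℂ where
  toFun X := of fun p q => ∑ i, ∑ j, X i j * Z (i, p) (j, q)
  map_add' _ _ := by ext; simp [add_mul, Finset.sum_add_distrib]
  map_smul' _ _ := by ext; simp [Finset.mul_sum, mul_assoc]

theorem choi_ofChoi (Z : Matrix (c × d) (c × d) ℂ) : choi (ofChoi Z) = Z := by
  ext p q
  simp [choi_apply, ofChoi, single_apply, ite_and]

/-- Choi's theorem. -/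
theorem isCP_iff_choi_posSemidef [Fintype d] (N : Matrix c c ℂ →ₗ[ℂ] Matrix d d ℂ) :
    IsCP N ↔ (choi N).PosSemidef := by
  refine ⟨fun h => ?_, fun h n X hX => ?_⟩
  -- Complete positivity quantifies over references `Fin n`, so the copy of `c` in the Choi operator
  -- is reindexed.
  · let e := Fintype.equivFin c
    have := (h _ _ ((posSemidef_vecMulVec_self_star (gammaVec c)).submatrix
      (Prod.map e.symm id))).submatrix (Prod.map e id)
    convert this using 1
    ext p q
    simp [choi, ampl]
  · rw [ampl_eq_link]
    exact link_posSemidef h hX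

/-- Trace preservation in terms of the Choi operator. -/
theorem tracePreserving_iff_choi [Fintype d] (N : Matrix c c ℂ →ₗ[ℂ] Matrix d d ℂ) :
    (∀ X, (N X).trace = X.trace) ↔ traceRight c d (choi N) = 1 := by
  have key : ∀ i j, traceRight c d (choi N) i j = (N (single i j 1)).trace := fun i j => by
    simp [traceRight, choi_apply, Matrix.trace]
  refine ⟨fun h => ?_, fun h X => ?_⟩
  · ext i j
    rw [key, h]
    rcases eq_or_ne i j with rfl | hij
    · simp
    · simp [hij]
  · have : (N X).trace = ∑ i, ∑ j, X i j * traceRight c d (choi N) i j := by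
      simp only [Matrix.trace, Matrix.diag, apply_eq_sum_choi N X, traceRight, LinearMap.coe_mk,
        AddHom.coe_mk, of_apply, Finset.mul_sum]
      rw [Finset.sum_comm]
      refine Finset.sum_congr rfl fun i _ => Finset.sum_comm
    rw [this, h]
    simp [Matrix.one_apply, Matrix.trace]

theorem isChannel_iff_choi [Fintype d] (N : Matrix c c ℂ →ₗ[ℂ] Matrix d d ℂ) :
    IsChannel N ↔ (choi N).PosSemidef ∧ traceRight c d (choi N) = 1 := by
  rw [IsChannel, isCP_iff_choi_posSemidef, tracePreserving_iff_choi]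

end Choi

/-! ### Pure inputs, which act on Choi operators by congruence. -/

section Pure

variable {c d : Type*} [Fintype c]

/-- The rank-one operator on `RC` whose vector has the matrix of coefficients `S`. -/
def pureOp {r c : Type*} (S : Matrix r c ℂ) : Matrix (r × c) (r × c) ℂ :=
  vecMulVec (fun p => S p.1 p.2) (star fun p => S p.1 p.2)

theorem pureOp_posSemidef {r : Type*} [Fintype r] (S : Matrix r c ℂ) : (pureOp S).PosSemidef :=
  posSemidef_vecMulVec_self_star _

/-- Contraction with `pureOp S` is Z ↦ (S ⊗ 1) Z (S ⊗ 1)ᴴ. Hence it composes multiplicatively in S,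
and an invertible S can be undone. -/
theorem link_pureOp_one [DecidableEq c] (Z : Matrix (c × d) (c × d) ℂ) :
    link Z (pureOp (1 : Matrix c c ℂ)) = Z := by
  ext p q
  simp [link, pureOp, vecMulVec_apply, Matrix.one_apply]

theorem sum_comm_pairs {i j k l : Type*} [Fintype i] [Fintype j] [Fintype k] [Fintype l]
    (F : i → j → k → l → ℂ) :
    ∑ a, ∑ b, ∑ x, ∑ y, F a b x y = ∑ x, ∑ y, ∑ a, ∑ b, F a b x y := by
  have : ∑ p : i × j, ∑ q : k × l, F p.1 p.2 q.1 q.2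
      = ∑ q : k × l, ∑ p : i × j, F p.1 p.2 q.1 q.2 :=
    Finset.sum_comm
  simpa only [Fintype.sum_prod_type] using this

theorem link_link_pureOp {r t : Type*} [Fintype r] (Z : Matrix (c × d) (c × d) ℂ)
    (S : Matrix r c ℂ) (T : Matrix t r ℂ) :
    link (link Z (pureOp S)) (pureOp T) = link Z (pureOp (T * S)) := by
  ext p q
  simp only [link, pureOp, vecMulVec_apply, of_apply, Pi.star_apply, Matrix.mul_apply, star_sum,
    star_mul', Finset.mul_sum, Finset.sum_mul]
  calc _ = ∑ k, ∑ l, ∑ i, ∑ j, T p.1 k * S k i * (star (T q.1 l) * star (S l j)) *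
        Z (i, p.2) (j, q.2) := by
        refine Finset.sum_congr rfl fun k _ => Finset.sum_congr rfl fun l _ =>
          Finset.sum_congr rfl fun i _ => Finset.sum_congr rfl fun j _ => ?_
        ring
    _ = ∑ i, ∑ j, ∑ k, ∑ l, T p.1 k * S k i * (star (T q.1 l) * star (S l j)) *
        Z (i, p.2) (j, q.2) := sum_comm_pairs _
    _ = _ := by
        refine Finset.sum_congr rfl fun i _ => Finset.sum_congr rfl fun j _ => ?_
        exact Finset.sum_comm

theorem trace_link_pureOp {r : Type*} [Fintype r] [Fintype d] (Z : Matrix (c × d) (c × d) ℂ)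
    (S : Matrix r c ℂ) : (link Z (pureOp S)).trace = (Sᴴ * S * traceRight c d Z).trace := by
  rw [trace_link]
  simp only [Matrix.trace, Matrix.diag, Matrix.mul_apply, pureOp, vecMulVec_apply,
    submatrix_apply, transpose_apply, conjTranspose_apply, Pi.star_apply, Finset.sum_mul]
  calc _ = ∑ k, ∑ j, ∑ i, S k i * star (S k j) * traceRight c d Z i j :=
        Finset.sum_congr rfl fun k _ => Finset.sum_comm
    _ = ∑ j, ∑ k, ∑ i, S k i * star (S k j) * traceRight c d Z i j := Finset.sum_comm
    _ = ∑ j, ∑ i, ∑ k, S k i * star (S k j) * traceRight c d Z i j :=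
        Finset.sum_congr rfl fun j _ => Finset.sum_comm
    _ = _ := by simp only [mul_comm (star _)]

theorem traceRight_posSemidef {c d : Type*} [Fintype d] {Z : Matrix (c × d) (c × d) ℂ}
    (hZ : Z.PosSemidef) : (traceRight c d Z).PosSemidef := by
  have : traceRight c d Z = ∑ k, Z.submatrix (fun i => (i, k)) (fun i => (i, k)) := by
    ext i j
    simp [traceRight, Matrix.sum_apply]
  rw [this]
  exact posSemidef_sum _ fun k _ => hZ.submatrix _

theorem trace_pureOp {r : Type*} [Fintype r] (S : Matrix r c ℂ) :
    (pureOp S).trace = (Sᴴ * S).trace := by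
  simp only [Matrix.trace, Matrix.diag, Matrix.mul_apply, pureOp, vecMulVec_apply,
    conjTranspose_apply, Pi.star_apply, Fintype.sum_prod_type]
  rw [Finset.sum_comm]
  simp only [mul_comm]

/-- A Hermitian matrix with nonnegative expectation in every state is positive semidefinite. -/
theorem posSemidef_of_trace_mul_state {A : Matrix c c ℂ} (hA : A.IsHermitian)
    (h : ∀ σ : Matrix c c ℂ, IsState σ → 0 ≤ (σ * A).trace.re) : A.PosSemidef := by
  classical
  rw [hA.posSemidef_iff_eigenvalues_nonneg]
  intro i
  set v : c → ℂ := ⇑(hA.eigenvectorBasis i) with hv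
  have hv1 : star v ⬝ᵥ v = 1 := by
    have := (EuclideanSpace.inner_eq_star_dotProduct (hA.eigenvectorBasis i)
      (hA.eigenvectorBasis i))
    rw [inner_self_eq_norm_sq_to_K, hA.eigenvectorBasis.norm_eq_one] at this
    rw [dotProduct_comm]
    simpa using this.symm
  have := h (vecMulVec v (star v)) ⟨posSemidef_vecMulVec_self_star v, by
    rw [trace_vecMulVec, dotProduct_comm, hv1]⟩
  rw [vecMulVec_mul, trace_vecMulVec, dotProduct_comm, ← dotProduct_mulVec] at this
  rw [hA.eigenvalues_eq]
  exact this

end Pure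

/-! ### The diamond distance of channels as a semidefinite program. -/

section Diamond

variable {c d : Type*} [Fintype c] [Fintype d] [DecidableEq c] [DecidableEq d]
  {N M : Matrix c c ℂ →ₗ[ℂ] Matrix d d ℂ}

theorem trace_link_choi_of_isChannel {r c d : Type*} [Fintype r] [Fintype c] [Fintype d]
    [DecidableEq c] {N : Matrix c c ℂ →ₗ[ℂ] Matrix d d ℂ} (hN : IsChannel N)
    (X : Matrix (r × c) (r × c) ℂ) : (link (choi N) X).trace = X.trace := by
  rw [trace_link, ((isChannel_iff_choi N).1 hN).2]
  simp [Matrix.trace, Fintype.sum_prod_type]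

theorem trace_link_choi_sub {r c d : Type*} [Fintype r] [Fintype c] [Fintype d]
    [DecidableEq c] {N M : Matrix c c ℂ →ₗ[ℂ] Matrix d d ℂ} (hN : IsChannel N) (hM : IsChannel M)
    (X : Matrix (r × c) (r × c) ℂ) : (link (choi N - choi M) X).trace = 0 := by
  rw [link_sub, trace_sub, trace_link_choi_of_isChannel hN, trace_link_choi_of_isChannel hM,
    sub_self]

/-- Weak duality: a feasible `Z` bounds the distance of the outputs on every state. -/
theorem traceNorm_ampl_sub_le (hN : IsChannel N) (hM : IsChannel M) {μ : ℝ}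
    {Z : Matrix (c × d) (c × d) ℂ} (hZ : Z.PosSemidef)
    (hZJ : (Z - (choi N - choi M)).PosSemidef)
    (hμ : ((μ : ℂ) • (1 : Matrix c c ℂ) - traceRight c d Z).PosSemidef) {n : ℕ}
    {X : Matrix (Fin n × c) (Fin n × c) ℂ} (hX : IsState X) :
    traceNorm (ampl (Fin n) N X - ampl (Fin n) M X) ≤ 2 * μ := by
  rw [ampl_eq_link, ampl_eq_link, ← link_sub]
  refine (traceNorm_le_of_posSemidef_sub (trace_link_choi_sub hN hM X)
    (link_posSemidef hZ hX.1) ?_).trans ?_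
  · rw [← link_sub]
    exact link_posSemidef hZJ hX.1
  · have := re_trace_link_le hμ hX.1
    rw [hX.2, Complex.one_re, mul_one] at this
    linarith

theorem bddAbove_diamondDist (hN : IsChannel N) (hM : IsChannel M) :
    BddAbove {x : ℝ | ∃ (n : ℕ) (ρ : Matrix (Fin n × c) (Fin n × c) ℂ), IsState ρ ∧
      x = traceNorm (ampl (Fin n) N ρ - ampl (Fin n) M ρ)} := by
  have h1 := (isChannel_iff_choi N).1 hN
  have h2 := (isChannel_iff_choi M).1 hM
  -- Z = Γ^N is feasible with μ = 1, since Γ^N − (Γ^N − Γ^M) = Γ^M ≥ 0.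
  refine ⟨2 * 1, ?_⟩
  rintro x ⟨n, ρ, hρ, rfl⟩
  refine traceNorm_ampl_sub_le hN hM h1.1 (by simpa using h2.1) ?_ hρ
  rw [h1.2]
  simpa using PosSemidef.zero

theorem diamondDist_le (hN : IsChannel N) (hM : IsChannel M) {μ : ℝ} (h0 : 0 ≤ μ)
    {Z : Matrix (c × d) (c × d) ℂ} (hZ : Z.PosSemidef)
    (hZJ : (Z - (choi N - choi M)).PosSemidef)
    (hμ : ((μ : ℂ) • (1 : Matrix c c ℂ) - traceRight c d Z).PosSemidef) :
    diamondDist N M ≤ 2 * μ := by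
  -- The sign of μ matters when `c` is empty: there are no states and the supremum defaults to 0.
  refine Real.sSup_le ?_ (by linarith)
  rintro x ⟨n, ρ, hρ, rfl⟩
  exact traceNorm_ampl_sub_le hN hM hZ hZJ hμ hρ

theorem traceNorm_nonneg (X : Matrix d d ℂ) : 0 ≤ traceNorm X := by
  open scoped MatrixOrder in
  rw [traceNorm_eq_trace_abs]
  exact (Complex.le_def.1 (CFC.abs_nonneg X).posSemidef.trace_nonneg).1

theorem diamondDist_nonneg {c d : Type*} [Fintype c] [Fintype d] [DecidableEq d]
    (N M : Matrix c c ℂ →ₗ[ℂ] Matrix d d ℂ) : 0 ≤ diamondDist N M := by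
  refine Real.sSup_nonneg ?_
  rintro x ⟨n, ρ, -, rfl⟩
  exact traceNorm_nonneg _

/-- For each positive definite state there is a feasible `Z` whose expectation is at most half the
diamond distance. -/
theorem exists_feasible_of_posDef (hN : IsChannel N) (hM : IsChannel M) {σ : Matrix c c ℂ}
    (hσ : σ.PosDef) (htr : σ.trace = 1) :
    ∃ Z : Matrix (c × d) (c × d) ℂ, Z.PosSemidef ∧ (Z - (choi N - choi M)).PosSemidef ∧
      2 * (σ * traceRight c d Z).trace.re ≤ diamondDist N M := by
  obtain ⟨S₀, hS₀, hS₀σ⟩ : ∃ S : Matrix c c ℂ, IsUnit S ∧ Sᴴ * S = σ := by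
    open scoped MatrixOrder in
    obtain ⟨S, hS⟩ := CStarAlgebra.nonneg_iff_eq_star_mul_self.mp hσ.posSemidef.nonneg
    refine ⟨S, ?_, hS.symm⟩
    have := hσ.isUnit
    rw [hS] at this
    exact (Matrix.isUnit_iff_isUnit_det _).2 (isUnit_of_mul_isUnit_right
      (by rw [← det_mul]; exact (Matrix.isUnit_iff_isUnit_det _).1 this))
  let e := Fintype.equivFin c
  let S : Matrix (Fin (Fintype.card c)) c ℂ := S₀.submatrix e.symm id
  let T : Matrix c (Fin (Fintype.card c)) ℂ := S₀⁻¹.submatrix id e.symm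
  have hTS : T * S = 1 := by
    rw [Matrix.submatrix_mul_equiv, Matrix.nonsing_inv_mul _
      ((Matrix.isUnit_iff_isUnit_det _).1 hS₀), submatrix_id_id]
  have hST : S * T = 1 := by
    rw [← Matrix.submatrix_mul _ _ _ _ _ Function.bijective_id, Matrix.mul_nonsing_inv _
      ((Matrix.isUnit_iff_isUnit_det _).1 hS₀), submatrix_one_equiv]
  have hSσ : Sᴴ * S = σ := by
    rw [conjTranspose_submatrix, Matrix.submatrix_mul_equiv, hS₀σ, submatrix_id_id]
  set J := choi N - choi M with hJ
  have hJh : J.IsHermitian :=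
    ((isChannel_iff_choi N).1 hN).1.1.sub ((isChannel_iff_choi M).1 hM).1.1
  have hω : IsState (pureOp S) := ⟨pureOp_posSemidef S, by rw [trace_pureOp, hSσ, htr]⟩
  have hKh : (link J (pureOp S)).IsHermitian := by
    rw [hJ, link_sub]
    exact (link_posSemidef ((isChannel_iff_choi N).1 hN).1 hω.1).1.sub
      (link_posSemidef ((isChannel_iff_choi M).1 hM).1 hω.1).1
  obtain ⟨P, hP, hPK, hPt⟩ := exists_posSemidef_trace_eq hKh (trace_link_choi_sub hN hM _)
  -- T inverts S, so this pulls the positive part of the output difference back to the Choi level.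
  refine ⟨link P (pureOp T), link_posSemidef hP (pureOp_posSemidef T), ?_, ?_⟩
  · have := link_posSemidef hPK (pureOp_posSemidef T)
    rwa [link_sub, link_link_pureOp, hTS, link_pureOp_one] at this
  · rw [← hSσ, ← trace_link_pureOp, link_link_pureOp, hST, link_pureOp_one, hPt]
    refine le_csSup (bddAbove_diamondDist hN hM) ⟨_, _, hω, ?_⟩
    rw [ampl_eq_link, ampl_eq_link, ← link_sub]

/-- For each state there is a feasible `Z` whose expectation is less than `μ`. -/
theorem exists_feasible_of_isState (hN : IsChannel N) (hM : IsChannel M) {μ : ℝ}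
    (hμ : diamondDist N M < 2 * μ) {σ : Matrix c c ℂ} (hσ : IsState σ) :
    ∃ Z : Matrix (c × d) (c × d) ℂ, (Z.PosSemidef ∧ (Z - (choi N - choi M)).PosSemidef) ∧
      (σ * traceRight c d Z).trace.re < μ := by
  have hc := hσ.nonempty
  set D := diamondDist N M
  have hD : 0 ≤ D := diamondDist_nonneg N M
  have hμ0 : 0 < μ := by linarith
  -- With this ε, 2(1 − ε)μ = μ + D/2 > D, so an expectation of at least μ in σ would contradict the
  -- bound D for the mixed state.
  set ε : ℝ := (2 * μ - D) / (4 * μ) with hε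
  have hε0 : 0 < ε := div_pos (by linarith) (by linarith)
  have hεμ : ε * (4 * μ) = 2 * μ - D := div_mul_cancel₀ _ (by linarith)
  have hε1 : 0 ≤ 1 - ε := by
    have : ε ≤ 1 := by rw [hε, div_le_one (by linarith)]; linarith
    linarith
  set τ : Matrix c c ℂ := (Fintype.card c : ℝ)⁻¹ • 1 with hτ
  have hn : (0 : ℝ) < Fintype.card c := by exact_mod_cast Fintype.card_pos
  have hτp : τ.PosDef := PosDef.one.smul (inv_pos.2 hn)
  have hτt : τ.trace = 1 := by
    rw [hτ, trace_smul, trace_one, Complex.real_smul]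
    push_cast
    exact inv_mul_cancel₀ (by exact_mod_cast hn.ne')
  obtain ⟨Z, hZ, hZJ, h⟩ := exists_feasible_of_posDef hN hM
    (σ := (1 - ε) • σ + ε • τ) ((hτp.smul hε0).posSemidef_add (hσ.1.smul hε1))
    (by rw [trace_add, trace_smul, trace_smul, hσ.2, hτt, ← add_smul]; simp)
  refine ⟨Z, ⟨hZ, hZJ⟩, ?_⟩
  have hτZ : 0 ≤ (τ * traceRight c d Z).trace.re :=
    (Complex.le_def.1 (trace_mul_nonneg hτp.posSemidef (traceRight_posSemidef hZ))).1
  rw [add_mul, trace_add, Complex.add_re, smul_mul_assoc, smul_mul_assoc, trace_smul, trace_smul,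
    Complex.smul_re, Complex.smul_re, smul_eq_mul, smul_eq_mul] at h
  have := mul_nonneg hε0.le hτZ
  by_contra! hcon
  nlinarith [mul_le_mul_of_nonneg_left hcon hε1]

/-- Strong duality: above half the diamond distance there is a feasible `Z`. -/
theorem exists_feasible (hN : IsChannel N) (hM : IsChannel M) {μ : ℝ}
    (hμ : diamondDist N M < 2 * μ) :
    ∃ Z : Matrix (c × d) (c × d) ℂ, Z.PosSemidef ∧ (Z - (choi N - choi M)).PosSemidef ∧
      ((μ : ℂ) • (1 : Matrix c c ℂ) - traceRight c d Z).PosSemidef := by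
  classical
  set J := choi N - choi M with hJ
  have hN' := (isChannel_iff_choi N).1 hN
  have hM' := (isChannel_iff_choi M).1 hM
  rcases isEmpty_or_nonempty c with hc | hc
  · refine ⟨choi N, hN'.1, by simpa [hJ] using hM'.1, ?_⟩
    rw [Subsingleton.elim (_ - _ : Matrix c c ℂ) 0]
    exact PosSemidef.zero
  let Y : Set (Matrix (c × d) (c × d) ℂ) := {Z | Z.PosSemidef ∧ (Z - J).PosSemidef}
  let X : Set (Matrix c c ℂ) := {σ | IsState σ}
  have hY : Convex ℝ Y := by
    rintro Z ⟨h1, h2⟩ W ⟨h3, h4⟩ s t hs ht hst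
    refine ⟨(h1.smul hs).add (h3.smul ht), ?_⟩
    have : s • Z + t • W - J = s • (Z - J) + t • (W - J) := by
      rw [smul_sub s Z, smul_sub t W, sub_add_sub_comm, ← add_smul, hst, one_smul]
    rw [this]
    exact (h2.smul hs).add (h4.smul ht)
  have hX : X.Nonempty := by
    refine ⟨(Fintype.card c : ℝ)⁻¹ • 1, PosSemidef.one.smul (by positivity), ?_⟩
    rw [trace_smul, trace_one, Complex.real_smul]
    push_cast
    exact inv_mul_cancel₀ (by exact_mod_cast Fintype.card_ne_zero)
  -- The minus sign matches the minimax form used: a value above −μ at each state, reached by some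
  -- Z, becomes a single Z exceeding −μ at all states.
  let f : Matrix c c ℂ →ₗ[ℝ] Matrix (c × d) (c × d) ℂ →ₗ[ℝ] ℝ :=
    LinearMap.mk₂ ℝ (fun σ Z => -(σ * traceRight c d Z).trace.re)
      (fun _ _ _ => by simp [add_mul]; ring) (fun _ _ _ => by simp)
      (fun _ _ _ => by simp [mul_add]; ring) (fun r σ Z => by
        have : traceRight c d (r • Z) = r • traceRight c d Z :=
          (traceRight c d).map_smul (r : ℂ) Z
        simp [this])
  have hf : ∀ σ Z, f σ Z = -(σ * traceRight c d Z).trace.re := fun _ _ => rfl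
  have hcont : ∀ Z, Continuous fun σ => f σ Z := fun Z =>
    (Complex.continuous_re.comp
      (Continuous.matrix_trace (continuous_id.matrix_mul continuous_const))).neg
  have hcont' : ∀ σ, Continuous fun Z => f σ Z := fun σ =>
    LinearMap.continuous_of_finiteDimensional (f σ)
  -- By compactness, finitely many Z already serve all states, as the finite form of Sion's theorem
  -- requires.
  obtain ⟨s, hs⟩ := isCompact_isState.elim_finite_subcover
    (fun Z : Y => {σ : Matrix c c ℂ | -μ < f σ Z})
    (fun Z => isOpen_lt continuous_const (hcont Z)) fun σ hσ => by
      obtain ⟨Z, hZ, hlt⟩ := exists_feasible_of_isState hN hM hμ hσ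
      refine Set.mem_iUnion.2 ⟨⟨Z, hZ⟩, ?_⟩
      change -μ < f σ Z
      rw [hf]
      linarith
  obtain ⟨Z, ⟨hZ, hZJ⟩, h⟩ := Sion.exists_lt_iInf_of_lt_iInf_of_finite (X := X) (Y := Y)
    (f := fun σ Z => f σ Z) hX isCompact_isState
    (fun Z _ => (hcont Z).continuousOn.lowerSemicontinuousOn)
    (fun Z _ => ((f.flip Z).convexOn convex_isState).quasiconvexOn) hY
    (fun σ _ => (hcont' σ).continuousOn.upperSemicontinuousOn)
    (fun σ _ => ((f σ).concaveOn hY).quasiconcaveOn) convex_isState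
    (s := Subtype.val '' (s : Set Y)) (s.finite_toSet.image _)
    (by rintro _ ⟨Z, -, rfl⟩; exact Z.2) (t := -μ) (fun σ hσ => by
      obtain ⟨Z, hZs, hlt⟩ := Set.mem_iUnion₂.1 (hs hσ)
      exact ⟨Z, ⟨Z, hZs, rfl⟩, hlt⟩)
  refine ⟨Z, hZ, hZJ, posSemidef_of_trace_mul_state ?_ fun σ hσ => ?_⟩
  · refine IsHermitian.sub ?_ (traceRight_posSemidef hZ).1
    rw [IsHermitian, conjTranspose_smul, conjTranspose_one, Complex.star_def, Complex.conj_ofReal]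
  · have := h σ hσ
    rw [hf] at this
    rw [mul_sub, trace_sub, mul_smul_comm, mul_one, trace_smul, hσ.2, smul_eq_mul, mul_one,
      Complex.sub_re, Complex.ofReal_re]
    linarith

end Diamond

/-! ### Simulations in Choi form, and the value of the primal program. -/

section Simulation

variable {a b ah bh a' b' : Type*}

/-- The Choi operator of `P : (AÂ)(BB̂) → A'B'`, its systems ordered as `(AB)(ÂB̂)(A'B')`. -/
def simChoi [DecidableEq a] [DecidableEq b] [DecidableEq ah] [DecidableEq bh]
    (P : Matrix ((a × ah) × (b × bh)) ((a × ah) × (b × bh)) ℂ →ₗ[ℂ]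
      Matrix (a' × b') (a' × b') ℂ) :
    Matrix (((a × b) × (ah × bh)) × (a' × b')) (((a × b) × (ah × bh)) × (a' × b')) ℂ :=
  (choi P).submatrix (Prod.map (Equiv.prodProdProdComm a b ah bh) id)
    (Prod.map (Equiv.prodProdProdComm a b ah bh) id)

theorem posSemidef_submatrix_prodMap {x y z : Type*} [Fintype x] [Fintype y] (e : x ≃ y)
    (M : Matrix (y × z) (y × z) ℂ) :
    (M.submatrix (Prod.map e id) (Prod.map e id)).PosSemidef ↔ M.PosSemidef :=
  posSemidef_submatrix_equiv (e.prodCongr (Equiv.refl z))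

section

variable [Fintype a] [Fintype b] [Fintype ah] [Fintype bh] [Fintype a'] [Fintype b']
  [DecidableEq a] [DecidableEq b] [DecidableEq ah] [DecidableEq bh]
  [DecidableEq a'] [DecidableEq b']

theorem choi_simulation (ρ : Matrix (ah × bh) (ah × bh) ℂ)
    (P : Matrix ((a × ah) × (b × bh)) ((a × ah) × (b × bh)) ℂ →ₗ[ℂ]
      Matrix (a' × b') (a' × b') ℂ) :
    choi (simulation ρ P) = contract (a × b) (a' × b') ρ (simChoi P) := by
  ext ⟨i, u⟩ ⟨j, v⟩
  rw [choi_apply, simulation, LinearMap.comp_apply, apply_eq_sum_choi P]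
  have hl : ∀ F : (a × ah) × (b × bh) → (a × ah) × (b × bh) → ℂ,
      ∑ x, ∑ y, attach ρ (single i j 1) x y * F x y
        = ∑ k, ∑ l, ρ k l * F ((i.1, k.1), (i.2, k.2)) ((j.1, l.1), (j.2, l.2)) := by
    intro F
    rw [← (Equiv.prodProdProdComm a b ah bh).sum_comp]
    simp_rw [← (Equiv.prodProdProdComm a b ah bh).sum_comp
      (fun y => attach ρ (single i j 1) _ y * F _ y)]
    simp only [Fintype.sum_prod_type (α₁ := a × b)]
    rw [Finset.sum_eq_single i (fun x _ hx => ?_) (by simp)]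
    · refine Finset.sum_congr rfl fun k _ => ?_
      rw [Finset.sum_eq_single j (fun y _ hy => ?_) (by simp)]
      · simp [attach, Equiv.prodProdProdComm]
      · simp [attach, Equiv.prodProdProdComm, hy.symm]
    · simp [attach, Equiv.prodProdProdComm, hx.symm]
  rw [hl (fun x y => choi P (x, u) (y, v)), Finset.sum_comm]
  simp only [contract, traceMid, LinearMap.comp_apply, LinearMap.coe_mk, AddHom.coe_mk, of_apply,
    LinearMap.mulLeft_apply, Matrix.mul_apply, kroneckerMap_apply, transpose_apply]
  refine Finset.sum_congr rfl fun l _ => ?_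
  simp [Fintype.sum_prod_type (α₁ := (a × b) × (ah × bh)), Fintype.sum_prod_type (α₁ := a × b),
    Matrix.one_apply, simChoi, Equiv.prodProdProdComm]

/-- Transposing an input matrix unit on Bob's side swaps his row and column indices, so the PPT
condition becomes positivity of a partially transposed Choi operator. -/
theorem transposeBob_simChoi
    (P : Matrix ((a × ah) × (b × bh)) ((a × ah) × (b × bh)) ℂ →ₗ[ℂ]
      Matrix (a' × b') (a' × b') ℂ) :
    transposeBob a b ah bh a' b' (simChoi P)
      = simChoi (transposeRight a' b' ∘ₗ P ∘ₗ transposeRight (a × ah) (b × bh)) := by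
  have h : ∀ i j : (a × ah) × (b × bh), transposeRight (a × ah) (b × bh) (single i j 1)
      = single (i.1, j.2) (j.1, i.2) 1 := by
    intro i j
    ext p q
    simp only [transposeRight, LinearMap.coe_mk, AddHom.coe_mk, of_apply, single_apply,
      Prod.ext_iff]
    congr 1
    apply propext
    tauto
  ext p q
  simp only [simChoi, transposeBob, LinearMap.coe_mk, AddHom.coe_mk, of_apply, submatrix_apply,
    choi_apply, LinearMap.comp_apply, h]
  rfl

theorem traceRight_simChoi
    (P : Matrix ((a × ah) × (b × bh)) ((a × ah) × (b × bh)) ℂ →ₗ[ℂ]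
      Matrix (a' × b') (a' × b') ℂ) :
    traceRight ((a × b) × (ah × bh)) (a' × b') (simChoi P) = 1 ↔
      traceRight ((a × ah) × (b × bh)) (a' × b') (choi P) = 1 := by
  have : traceRight ((a × b) × (ah × bh)) (a' × b') (simChoi P)
      = reindex (Equiv.prodProdProdComm a b ah bh).symm (Equiv.prodProdProdComm a b ah bh).symm
        (traceRight ((a × ah) × (b × bh)) (a' × b') (choi P)) := rfl
  rw [this, ← (reindex (Equiv.prodProdProdComm a b ah bh).symm
    (Equiv.prodProdProdComm a b ah bh).symm).injective.eq_iff (b := 1)]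
  simp

theorem isCPPTP_iff (P : Matrix ((a × ah) × (b × bh)) ((a × ah) × (b × bh)) ℂ →ₗ[ℂ]
      Matrix (a' × b') (a' × b') ℂ) :
    IsCPPTP P ↔ (simChoi P).PosSemidef ∧
      (transposeBob a b ah bh a' b' (simChoi P)).PosSemidef ∧
      traceRight ((a × b) × (ah × bh)) (a' × b') (simChoi P) = 1 := by
  rw [IsCPPTP, isChannel_iff_choi, isCP_iff_choi_posSemidef, transposeBob_simChoi,
    traceRight_simChoi, simChoi, simChoi, posSemidef_submatrix_prodMap,
    posSemidef_submatrix_prodMap]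
  tauto

theorem exists_simChoi_eq
    (Q : Matrix (((a × b) × (ah × bh)) × (a' × b')) (((a × b) × (ah × bh)) × (a' × b')) ℂ) :
    ∃ P : Matrix ((a × ah) × (b × bh)) ((a × ah) × (b × bh)) ℂ →ₗ[ℂ]
      Matrix (a' × b') (a' × b') ℂ, simChoi P = Q := by
  refine ⟨ofChoi (Q.submatrix (Prod.map (Equiv.prodProdProdComm a b ah bh).symm id)
    (Prod.map (Equiv.prodProdProdComm a b ah bh).symm id)), ?_⟩
  rw [simChoi, choi_ofChoi]
  rfl

theorem isChannel_simulation {ρ : Matrix (ah × bh) (ah × bh) ℂ} (hρ : IsState ρ)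
    {P : Matrix ((a × ah) × (b × bh)) ((a × ah) × (b × bh)) ℂ →ₗ[ℂ]
      Matrix (a' × b') (a' × b') ℂ} (hP : IsChannel P) : IsChannel (simulation ρ P) := by
  refine ⟨fun n X hX => ?_, fun X => ?_⟩
  -- The ampliated simulation at X is, by definition, the ampliation of P at X ⊗ ρ with its systems
  -- reordered.
  · exact hP.1 n _ ((hX.kronecker hρ.1).submatrix fun p : Fin n × ((a × ah) × (b × bh)) =>
      ((p.1, (p.2.1.1, p.2.2.1)), (p.2.1.2, p.2.2.2)))
  · rw [simulation, LinearMap.comp_apply, hP.2]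
    have h := trace_kronecker X ρ
    rw [hρ.2, mul_one] at h
    rw [← h]
    exact (Equiv.prodProdProdComm a ah b bh).sum_comp fun p => (X ⊗ₖ ρ) p p

theorem nonempty_of_isChannel {c d : Type*} [Fintype c] [Fintype d] [Nonempty c]
    {N : Matrix c c ℂ →ₗ[ℂ] Matrix d d ℂ} (hN : IsChannel N) : Nonempty d := by
  classical
  by_contra hd
  rw [not_nonempty_iff] at hd
  have := hN.2 (single (Classical.arbitrary c) (Classical.arbitrary c) 1)
  rw [trace_single_eq_same] at this
  simp [Matrix.trace] at this

/-- The completely depolarizing channel works: its Choi operator is a multiple of the identity,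
which partial transposition fixes. This keeps the infimum in `errPPT` from being over the empty set.
-/
theorem exists_isCPPTP {N : Matrix (a × b) (a × b) ℂ →ₗ[ℂ] Matrix (a' × b') (a' × b') ℂ}
    (hN : IsChannel N) :
    ∃ P : Matrix ((a × ah) × (b × bh)) ((a × ah) × (b × bh)) ℂ →ₗ[ℂ]
      Matrix (a' × b') (a' × b') ℂ, IsCPPTP P := by
  obtain ⟨P, hP⟩ := exists_simChoi_eq (a := a) (b := b) (ah := ah) (bh := bh)
    (a' := a') (b' := b') ((Fintype.card (a' × b') : ℝ)⁻¹ • 1)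
  have h1 : ((Fintype.card (a' × b') : ℝ)⁻¹ • 1 : Matrix (((a × b) × (ah × bh)) × (a' × b'))
      (((a × b) × (ah × bh)) × (a' × b')) ℂ).PosSemidef := PosSemidef.one.smul (by positivity)
  refine ⟨P, (isCPPTP_iff P).2 ?_⟩
  rw [hP]
  refine ⟨h1, ?_, ?_⟩
  · convert h1 using 1
    ext p q
    simp only [transposeBob, LinearMap.coe_mk, AddHom.coe_mk, of_apply, Matrix.smul_apply,
      Matrix.one_apply, Prod.ext_iff]
    congr 2
    apply propext
    tauto
  · rcases isEmpty_or_nonempty (a × b) with h | h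
    · exact Subsingleton.elim _ _
    -- Dividing by the output dimension is legitimate because N preserves trace, which forces a
    -- nonempty output.
    · have := nonempty_of_isChannel hN
      have hc : (Fintype.card (a' × b') : ℂ) ≠ 0 := by exact_mod_cast Fintype.card_ne_zero
      ext i j
      simp only [traceRight, LinearMap.coe_mk, AddHom.coe_mk, of_apply, Matrix.smul_apply,
        Matrix.one_apply, Prod.mk.injEq, and_true, Finset.sum_const, Finset.card_univ]
      split_ifs
      · rw [nsmul_eq_mul, Complex.real_smul, Complex.ofReal_inv, Complex.ofReal_natCast, mul_one,
          mul_inv_cancel₀ hc]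
      · simp

/-- The simulation error is the value of the primal program. -/
theorem isGLB_simPrimalValues
    {N : Matrix (a × b) (a × b) ℂ →ₗ[ℂ] Matrix (a' × b') (a' × b') ℂ}
    {ρ : Matrix (ah × bh) (ah × bh) ℂ} (hN : IsChannel N) (hρ : IsState ρ) :
    IsGLB (simPrimalValues N ρ) (errPPT N ρ) := by
  constructor
  · rintro μ ⟨Z, Q, h0, hZ, hQ, hμ, hT, htr, hZJ⟩
    obtain ⟨P, rfl⟩ := exists_simChoi_eq Q
    have hP := (isCPPTP_iff P).2 ⟨hQ, hT, htr⟩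
    rw [← choi_simulation] at hZJ
    have h := diamondDist_le hN (isChannel_simulation hρ hP.1) h0 hZ hZJ hμ
    have h' : errPPT N ρ ≤ 1 / 2 * diamondDist N (simulation ρ P) := by
      refine mul_le_mul_of_nonneg_left (csInf_le ⟨0, ?_⟩ ⟨P, hP, rfl⟩) (by norm_num)
      rintro _ ⟨P', -, rfl⟩
      exact diamondDist_nonneg _ _
    linarith
  · intro l hl
    have : 2 * l ≤ sInf {x : ℝ | ∃ P : Matrix ((a × ah) × (b × bh)) ((a × ah) × (b × bh)) ℂ →ₗ[ℂ]
        Matrix (a' × b') (a' × b') ℂ, IsCPPTP P ∧ x = diamondDist N (simulation ρ P)} := by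
      refine le_csInf ?_ ?_
      · obtain ⟨P, hP⟩ := exists_isCPPTP (ah := ah) (bh := bh) hN
        exact ⟨_, P, hP, rfl⟩
      · rintro _ ⟨P, hP, rfl⟩
        -- Feasibility is known only strictly above half the distance, which suffices for an
        -- infimum.
        refine le_of_forall_gt_imp_ge_of_dense fun x hx => ?_
        have hx' : diamondDist N (simulation ρ P) < 2 * (x / 2) := by linarith
        obtain ⟨Z, hZ, hZJ, hμ⟩ := exists_feasible hN (isChannel_simulation hρ hP.1) hx'
        obtain ⟨hQ, hT, htr⟩ := (isCPPTP_iff P).1 hP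
        rw [choi_simulation] at hZJ
        have := hl ⟨Z, simChoi P, by linarith [diamondDist_nonneg N (simulation ρ P)], hZ, hQ, hμ,
          hT, htr, hZJ⟩
        linarith
    rw [errPPT]
    linarith

end

end Simulation

/-! ### Block-diagonal matrices. -/

section Blocks

variable {p q : Type*}

theorem posSemidef_diag₂ [Fintype p] [Fintype q] {X : Matrix p p ℂ} {Y : Matrix q q ℂ} :
    (diag₂ X Y).PosSemidef ↔ X.PosSemidef ∧ Y.PosSemidef := by
  refine ⟨fun h => ⟨h.submatrix Sum.inl, h.submatrix Sum.inr⟩, fun ⟨hX, hY⟩ => ?_⟩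
  classical
  open scoped MatrixOrder in
  obtain ⟨C, rfl⟩ := CStarAlgebra.nonneg_iff_eq_star_mul_self.mp hX.nonneg
  obtain ⟨D, rfl⟩ := CStarAlgebra.nonneg_iff_eq_star_mul_self.mp hY.nonneg
  have := posSemidef_conjTranspose_mul_self (diag₂ C D)
  rw [diag₂, fromBlocks_conjTranspose, fromBlocks_multiply] at this
  simpa [diag₂, star_eq_conjTranspose] using this

theorem isHermitian_diag₂ {X : Matrix p p ℂ} {Y : Matrix q q ℂ} (hX : X.IsHermitian)
    (hY : Y.IsHermitian) : (diag₂ X Y).IsHermitian :=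
  hX.fromBlocks (by simp) hY

theorem diag₂_sub_diag₂ (X X' : Matrix p p ℂ) (Y Y' : Matrix q q ℂ) :
    diag₂ X Y - diag₂ X' Y' = diag₂ (X - X') (Y - Y') := by
  simp [diag₂, sub_eq_add_neg, fromBlocks_neg, fromBlocks_add]

theorem diag₂_conjTranspose (X : Matrix p p ℂ) (Y : Matrix q q ℂ) :
    (diag₂ X Y)ᴴ = diag₂ Xᴴ Yᴴ := by
  simp [diag₂, fromBlocks_conjTranspose]

theorem toBlocks₁₁_diag₂ (X : Matrix p p ℂ) (Y : Matrix q q ℂ) : (diag₂ X Y).toBlocks₁₁ = X := rfl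

theorem toBlocks₂₂_diag₂ (X : Matrix p p ℂ) (Y : Matrix q q ℂ) : (diag₂ X Y).toBlocks₂₂ = Y := rfl

theorem diag₂_apply_inl (X : Matrix p p ℂ) (Y : Matrix q q ℂ) (i j : p) :
    diag₂ X Y (Sum.inl i) (Sum.inl j) = X i j := rfl

theorem toBlocks₁₁_conjTranspose (M : Matrix (p ⊕ q) (p ⊕ q) ℂ) :
    Mᴴ.toBlocks₁₁ = M.toBlocks₁₁ᴴ := rfl

theorem toBlocks₂₂_conjTranspose (M : Matrix (p ⊕ q) (p ⊕ q) ℂ) :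
    Mᴴ.toBlocks₂₂ = M.toBlocks₂₂ᴴ := rfl

variable [Fintype p] [Fintype q]

theorem trace_mul_diag₂ (M : Matrix (p ⊕ q) (p ⊕ q) ℂ) (X : Matrix p p ℂ) (Y : Matrix q q ℂ) :
    (M * diag₂ X Y).trace = (M.toBlocks₁₁ * X).trace + (M.toBlocks₂₂ * Y).trace := by
  conv_lhs => rw [← fromBlocks_toBlocks M, diag₂, fromBlocks_multiply]
  simp [Matrix.trace]

theorem trace_diag₂_mul (M : Matrix (p ⊕ q) (p ⊕ q) ℂ) (X : Matrix p p ℂ) (Y : Matrix q q ℂ) :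
    (diag₂ X Y * M).trace = (X * M.toBlocks₁₁).trace + (Y * M.toBlocks₂₂).trace := by
  rw [trace_mul_comm, trace_mul_diag₂, trace_mul_comm, trace_mul_comm Y]

theorem posSemidef_unit_iff {M : Matrix Unit Unit ℂ} : M.PosSemidef ↔ 0 ≤ M () () := by
  have : M = diagonal fun _ => M () () := by ext; simp
  rw [this, posSemidef_diagonal_iff]
  simp

end Blocks

/-! ### Hilbert–Schmidt adjoints of the maps in the constraints. -/

section Adjoints

variable {m n k : Type*} [Fintype m] [Fintype n] [Fintype k] [DecidableEq m] [DecidableEq n]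

theorem SDP.adjoint_eq_of_trace {m n : Type*} [Fintype m] [Fintype n]
    {Φ : Matrix n n ℂ →ₗ[ℂ] Matrix m m ℂ} {X : Matrix m m ℂ} {M : Matrix n n ℂ} (h : ∀ Y, (Yᴴ * M).trace = ((Φ Y)ᴴ * X).trace) :
    SDP.adjoint Φ X = M := by
  classical
  ext i j
  rw [SDP.adjoint, of_apply, ← h]
  simp [Matrix.trace, Matrix.mul_apply, single_apply, ite_and]

theorem trace_traceRight_conjTranspose_mul {m : Type*} [Fintype m]
    (Z : Matrix (m × n) (m × n) ℂ) (X : Matrix m m ℂ) :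
    ((traceRight m n Z)ᴴ * X).trace = (Zᴴ * (X ⊗ₖ (1 : Matrix n n ℂ))).trace := by
  simp only [Matrix.trace, Matrix.diag, Matrix.mul_apply, conjTranspose_apply, traceRight,
    LinearMap.coe_mk, AddHom.coe_mk, of_apply, star_sum, Finset.sum_mul, Fintype.sum_prod_type,
    kroneckerMap_apply, Matrix.one_apply, mul_ite, mul_one, mul_zero,
    Finset.sum_ite_eq', Finset.mem_univ, if_true]
  exact Finset.sum_congr rfl fun _ _ => Finset.sum_comm

theorem contract_apply (ρ : Matrix k k ℂ) (P : Matrix ((m × k) × n) ((m × k) × n) ℂ)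
    (p q : m × n) :
    contract m n ρ P p q = ∑ x, ∑ y, ρ y x * P ((p.1, y), p.2) ((q.1, x), q.2) := by
  simp only [contract, traceMid, LinearMap.comp_apply, LinearMap.coe_mk, AddHom.coe_mk, of_apply,
    LinearMap.mulLeft_apply, Matrix.mul_apply, kroneckerMap_apply, transpose_apply]
  refine Finset.sum_congr rfl fun x _ => ?_
  simp [Fintype.sum_prod_type (α₁ := m × k), Fintype.sum_prod_type (α₁ := m), Matrix.one_apply]

/-- Left multiplication by ρᵀ alone need not respect adjoints; the partial trace over `k` repairs
this, being cyclic for operators acting on `k` only. -/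
theorem contract_conjTranspose {ρ : Matrix k k ℂ} (hρ : ρ.IsHermitian)
    (P : Matrix ((m × k) × n) ((m × k) × n) ℂ) :
    (contract m n ρ P)ᴴ = contract m n ρ Pᴴ := by
  ext p q
  simp only [conjTranspose_apply, contract_apply, star_sum, star_mul', hρ.apply]
  exact Finset.sum_comm

theorem trace_contract_conjTranspose_mul {ρ : Matrix k k ℂ} (hρ : ρ.IsHermitian)
    (P : Matrix ((m × k) × n) ((m × k) × n) ℂ) (X : Matrix (m × n) (m × n) ℂ) :
    ((contract m n ρ P)ᴴ * X).trace = (Pᴴ * insertMid X ρᵀ).trace := by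
  rw [contract_conjTranspose hρ]
  simp only [Matrix.trace, Matrix.diag, Matrix.mul_apply, contract_apply, insertMid,
    submatrix_apply, kroneckerMap_apply, transpose_apply, Fintype.sum_prod_type, Finset.sum_mul]
  refine Finset.sum_congr rfl fun i _ => .trans ?_ Finset.sum_comm
  refine Finset.sum_congr rfl fun u _ => .trans ?_ Finset.sum_comm
  refine Finset.sum_congr rfl fun j _ => .trans Finset.sum_comm (.trans ?_ Finset.sum_comm)
  refine Finset.sum_congr rfl fun x _ => Finset.sum_comm.trans ?_
  refine Finset.sum_congr rfl fun y _ => Finset.sum_congr rfl fun v _ => ?_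
  ring

end Adjoints

/-! ### The standard form and its dual. -/

section Programs

variable {a b ah bh a' b' : Type*}

theorem transposeBob_conjTranspose
    (X : Matrix (((a × b) × (ah × bh)) × (a' × b')) (((a × b) × (ah × bh)) × (a' × b')) ℂ) :
    (transposeBob a b ah bh a' b' X)ᴴ = transposeBob a b ah bh a' b' Xᴴ := rfl

variable [Fintype a] [Fintype b] [Fintype ah] [Fintype bh] [Fintype a'] [Fintype b']

theorem trace_transposeBob_mul
    (X Y : Matrix (((a × b) × (ah × bh)) × (a' × b')) (((a × b) × (ah × bh)) × (a' × b')) ℂ) :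
    (transposeBob a b ah bh a' b' X * Y).trace = (X * transposeBob a b ah bh a' b' Y).trace := by
  simp only [Matrix.trace, Matrix.diag, Matrix.mul_apply, ← Fintype.sum_prod_type']
  -- Swapping Bob's row and column indices is an involution on index pairs; reindexing the trace by
  -- it moves the partial transpose to the other factor.
  let e : ((((a × b) × (ah × bh)) × (a' × b')) × (((a × b) × (ah × bh)) × (a' × b'))) ≃
      ((((a × b) × (ah × bh)) × (a' × b')) × (((a × b) × (ah × bh)) × (a' × b'))) :=
    { toFun := fun p => ((((p.1.1.1.1, p.2.1.1.2), (p.1.1.2.1, p.2.1.2.2)), (p.1.2.1, p.2.2.2)),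
        (((p.2.1.1.1, p.1.1.1.2), (p.2.1.2.1, p.1.1.2.2)), (p.2.2.1, p.1.2.2)))
      invFun := fun p => ((((p.1.1.1.1, p.2.1.1.2), (p.1.1.2.1, p.2.1.2.2)), (p.1.2.1, p.2.2.2)),
        (((p.2.1.1.1, p.1.1.1.2), (p.2.1.2.1, p.1.1.2.2)), (p.2.2.1, p.1.2.2)))
      left_inv := fun _ => rfl
      right_inv := fun _ => rfl }
  exact e.sum_comp fun p => X p.1 p.2 * transposeBob a b ah bh a' b' Y p.2 p.1

variable [DecidableEq a] [DecidableEq b] [DecidableEq ah] [DecidableEq bh]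
  [DecidableEq a'] [DecidableEq b']

theorem simSDP_Φ_apply (N : Matrix (a × b) (a × b) ℂ →ₗ[ℂ] Matrix (a' × b') (a' × b') ℂ)
    (ρ : Matrix (ah × bh) (ah × bh) ℂ)
    (Y : Matrix (Unit ⊕ (((a × b) × (a' × b')) ⊕ (((a × b) × (ah × bh)) × (a' × b'))))
      (Unit ⊕ (((a × b) × (a' × b')) ⊕ (((a × b) × (ah × bh)) × (a' × b')))) ℂ) :
    (simSDP N ρ).Φ Y = diag₂ (Y (Sum.inl ()) (Sum.inl ()) • 1 -
        traceRight (a × b) (a' × b') Y.toBlocks₂₂.toBlocks₁₁)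
      (diag₂ (Y.toBlocks₂₂.toBlocks₁₁ + contract (a × b) (a' × b') ρ Y.toBlocks₂₂.toBlocks₂₂)
        (diag₂ (transposeBob a b ah bh a' b' Y.toBlocks₂₂.toBlocks₂₂)
          (diag₂ (traceRight ((a × b) × (ah × bh)) (a' × b') Y.toBlocks₂₂.toBlocks₂₂)
            (-traceRight ((a × b) × (ah × bh)) (a' × b') Y.toBlocks₂₂.toBlocks₂₂)))) := rfl

theorem traceRight_isHermitian {m n : Type*} [Fintype n] {Z : Matrix (m × n) (m × n) ℂ}
    (hZ : Z.IsHermitian) : (traceRight m n Z).IsHermitian := by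
  ext i j
  simp [traceRight, hZ.apply]

variable {N : Matrix (a × b) (a × b) ℂ →ₗ[ℂ] Matrix (a' × b') (a' × b') ℂ}
  {ρ : Matrix (ah × bh) (ah × bh) ℂ}

theorem simSDP_isHermitian (hN : IsChannel N) (hρ : IsState ρ) : (simSDP N ρ).IsHermitian := by
  refine ⟨?_, ?_, fun Y hY => ?_⟩
  · exact isHermitian_diag₂ isHermitian_zero (isHermitian_diag₂
      ((isChannel_iff_choi N).1 hN).1.1 (isHermitian_diag₂ isHermitian_zero
        (isHermitian_diag₂ isHermitian_one isHermitian_one.neg)))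
  · exact isHermitian_diag₂ isHermitian_one (isHermitian_diag₂ isHermitian_zero isHermitian_zero)
  · have hZ : Y.toBlocks₂₂.toBlocks₁₁.IsHermitian := hY.submatrix (Sum.inr ∘ Sum.inl)
    have hP : Y.toBlocks₂₂.toBlocks₂₂.IsHermitian := hY.submatrix (Sum.inr ∘ Sum.inr)
    rw [simSDP_Φ_apply]
    refine isHermitian_diag₂ (.sub ?_ (traceRight_isHermitian hZ)) (isHermitian_diag₂
      (hZ.add ?_) (isHermitian_diag₂ ?_ (isHermitian_diag₂ (traceRight_isHermitian hP)
        (traceRight_isHermitian hP).neg)))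
    · rw [IsHermitian, conjTranspose_smul, conjTranspose_one, hY.apply]
    · rw [IsHermitian, contract_conjTranspose hρ.1.1, hP.eq]
    · rw [IsHermitian, transposeBob_conjTranspose, hP.eq]

theorem eq_of_posSemidef_sub {m : Type*} [Fintype m] {A B : Matrix m m ℂ}
    (h1 : (A - B).PosSemidef) (h2 : (-A - -B).PosSemidef) : A = B := by
  open scoped MatrixOrder in
  refine le_antisymm (le_iff.2 ?_) (le_iff.2 h1)
  rwa [neg_sub_neg] at h2

theorem simSDP_primalValues : (simSDP N ρ).primalValues = simPrimalValues N ρ := by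
  ext v
  constructor
  · rintro ⟨Y, hY, h, rfl⟩
    rw [simSDP_Φ_apply] at h
    simp only [simSDP, diag₂_sub_diag₂, posSemidef_diag₂, sub_zero] at h
    obtain ⟨h1, h2, h3, h4, h5⟩ := h
    have hv : ((simSDP N ρ).B * Y).trace = Y (Sum.inl ()) (Sum.inl ()) := by
      simp only [simSDP, trace_diag₂_mul, zero_mul, trace_zero, one_mul, add_zero]
      simp [Matrix.trace, toBlocks₁₁]
    -- A diagonal entry of a positive semidefinite matrix is real, so the complex entry μ equals its
    -- real part.
    have h0 := Complex.le_def.1 (hY.diag_nonneg (i := Sum.inl ()))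
    have hre : ((Y (Sum.inl ()) (Sum.inl ())).re : ℂ) = Y (Sum.inl ()) (Sum.inl ()) :=
      Complex.ext (by simp) (by simpa using h0.2)
    rw [hv]
    refine ⟨Y.toBlocks₂₂.toBlocks₁₁, Y.toBlocks₂₂.toBlocks₂₂, h0.1,
      hY.submatrix (Sum.inr ∘ Sum.inl), hY.submatrix (Sum.inr ∘ Sum.inr), ?_, h3,
      eq_of_posSemidef_sub h4 h5, ?_⟩
    · rwa [hre]
    · rwa [sub_sub_eq_add_sub]
  · rintro ⟨Z, P, h0, hZ, hP, h1, h3, h4, h2⟩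
    refine ⟨diag₂ (of fun _ _ => (v : ℂ)) (diag₂ Z P), ?_, ?_, ?_⟩
    · rw [posSemidef_diag₂, posSemidef_diag₂, posSemidef_unit_iff]
      exact ⟨Complex.zero_le_real.2 h0, hZ, hP⟩
    · rw [simSDP_Φ_apply]
      simp only [simSDP, toBlocks₁₁_diag₂, toBlocks₂₂_diag₂, diag₂_apply_inl, diag₂_sub_diag₂,
        posSemidef_diag₂, sub_zero, of_apply]
      rw [sub_sub_eq_add_sub] at h2
      refine ⟨h1, h2, h3, ?_, ?_⟩
      · rw [h4, sub_self]
        exact PosSemidef.zero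
      · rw [h4, sub_self]
        exact PosSemidef.zero
    · simp only [simSDP, trace_diag₂_mul, zero_mul, trace_zero, one_mul, add_zero]
      simp [Matrix.trace, toBlocks₁₁_diag₂]

theorem simSDP_adjoint (hρ : IsState ρ)
    (X : Matrix ((a × b) ⊕ (((a × b) × (a' × b')) ⊕ ((((a × b) × (ah × bh)) × (a' × b')) ⊕
        (((a × b) × (ah × bh)) ⊕ ((a × b) × (ah × bh))))))
      ((a × b) ⊕ (((a × b) × (a' × b')) ⊕ ((((a × b) × (ah × bh)) × (a' × b')) ⊕
        (((a × b) × (ah × bh)) ⊕ ((a × b) × (ah × bh)))))) ℂ) :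
    SDP.adjoint (simSDP N ρ).Φ X = diag₂ (of fun _ _ => X.toBlocks₁₁.trace)
      (diag₂ (X.toBlocks₂₂.toBlocks₁₁ - X.toBlocks₁₁ ⊗ₖ (1 : Matrix (a' × b') (a' × b') ℂ))
        (insertMid X.toBlocks₂₂.toBlocks₁₁ ρᵀ
          + transposeBob a b ah bh a' b' X.toBlocks₂₂.toBlocks₂₂.toBlocks₁₁
          - (X.toBlocks₂₂.toBlocks₂₂.toBlocks₂₂.toBlocks₂₂
            - X.toBlocks₂₂.toBlocks₂₂.toBlocks₂₂.toBlocks₁₁) ⊗ₖ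
              (1 : Matrix (a' × b') (a' × b') ℂ))) := by
  refine SDP.adjoint_eq_of_trace fun Y => ?_
  have hk : ∀ A B : Matrix ((a × b) × (ah × bh)) ((a × b) × (ah × bh)) ℂ,
      (A - B) ⊗ₖ (1 : Matrix (a' × b') (a' × b') ℂ) = A ⊗ₖ 1 - B ⊗ₖ 1 := fun A B => by
    ext
    simp [sub_mul]
  have hs : (Y.toBlocks₁₁ᴴ * of fun _ _ => X.toBlocks₁₁.trace).trace
      = ((Y (Sum.inl ()) (Sum.inl ()) • (1 : Matrix (a × b) (a × b) ℂ))ᴴ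
        * X.toBlocks₁₁).trace := by
    rw [conjTranspose_smul, conjTranspose_one, smul_mul_assoc, one_mul, trace_smul, smul_eq_mul]
    generalize X.toBlocks₁₁.trace = t
    simp [Matrix.trace, Matrix.mul_apply, toBlocks₁₁]
  rw [simSDP_Φ_apply]
  simp only [diag₂_conjTranspose, trace_mul_diag₂, trace_diag₂_mul, toBlocks₁₁_conjTranspose,
    toBlocks₂₂_conjTranspose, conjTranspose_sub, conjTranspose_add, conjTranspose_neg, sub_mul,
    add_mul, neg_mul, trace_sub, trace_add, trace_neg, mul_sub, mul_add,
    trace_traceRight_conjTranspose_mul, trace_contract_conjTranspose_mul hρ.1.1,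
    transposeBob_conjTranspose, trace_transposeBob_mul, hk]
  rw [hs]
  ring

theorem simSDP_dualValues (hρ : IsState ρ) : (simSDP N ρ).dualValues = simDualValues N ρ := by
  ext v
  have h1 : ∀ t : ℂ, (((1 : Matrix Unit Unit ℂ) - of fun _ _ => t).PosSemidef ↔ 0 ≤ 1 - t) :=
    fun t => posSemidef_unit_iff
  constructor
  · rintro ⟨X, hX, h, rfl⟩
    rw [simSDP_adjoint hρ] at h
    simp only [simSDP, diag₂_sub_diag₂, posSemidef_diag₂, zero_sub, neg_sub, h1] at h
    refine ⟨X.toBlocks₁₁, X.toBlocks₂₂.toBlocks₁₁, X.toBlocks₂₂.toBlocks₂₂.toBlocks₁₁,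
      X.toBlocks₂₂.toBlocks₂₂.toBlocks₂₂.toBlocks₂₂
        - X.toBlocks₂₂.toBlocks₂₂.toBlocks₂₂.toBlocks₁₁,
      hX.submatrix Sum.inl, hX.submatrix (Sum.inr ∘ Sum.inl),
      hX.submatrix (Sum.inr ∘ Sum.inr ∘ Sum.inl),
      .sub (hX.1.submatrix (Sum.inr ∘ Sum.inr ∘ Sum.inr ∘ Sum.inr))
        (hX.1.submatrix (Sum.inr ∘ Sum.inr ∘ Sum.inr ∘ Sum.inl)), ?_, h.2.1, h.2.2, ?_⟩
    · have := (Complex.le_def.1 h.1).1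
      simp only [Complex.zero_re, Complex.sub_re, Complex.one_re] at this
      linarith
    · simp only [simSDP, trace_diag₂_mul, zero_mul, trace_zero, one_mul, neg_mul, trace_neg,
        zero_add, trace_sub, Complex.add_re, Complex.sub_re, Complex.neg_re]
      ring
  · rintro ⟨X₁, X₂, X₃, W, hX₁, hX₂, hX₃, hW, ht, h₂, h₃, rfl⟩
    open scoped MatrixOrder in
    have hWs : W⁺ - W⁻ = W := CFC.posPart_sub_negPart W hW
    -- The adjoint involves the last two blocks only through fifth minus fourth, here W⁺ − W⁻ = W.
    refine ⟨diag₂ X₁ (diag₂ X₂ (diag₂ X₃ (diag₂ W⁻ W⁺))), ?_, ?_, ?_⟩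
    · simp only [posSemidef_diag₂]
      open scoped MatrixOrder in
      exact ⟨hX₁, hX₂, hX₃, (CFC.negPart_nonneg W).posSemidef, (CFC.posPart_nonneg W).posSemidef⟩
    · rw [simSDP_adjoint hρ]
      simp only [simSDP, toBlocks₁₁_diag₂, toBlocks₂₂_diag₂, diag₂_sub_diag₂, posSemidef_diag₂,
        zero_sub, neg_sub, h1, hWs]
      refine ⟨Complex.le_def.2 ⟨by simpa using ht, ?_⟩, h₂, h₃⟩
      -- The order on ℂ also requires the trace of X₁ to be real, which positivity supplies.
      simpa using (Complex.le_def.1 hX₁.trace_nonneg).2.symm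
    · simp only [simSDP, toBlocks₁₁_diag₂, toBlocks₂₂_diag₂, trace_diag₂_mul, zero_mul,
        trace_zero, one_mul, neg_mul, trace_neg, zero_add]
      rw [← sub_eq_add_neg, ← neg_sub W⁺.trace, ← trace_sub, hWs, ← sub_eq_add_neg, Complex.sub_re]

end Programs

end QSim

end

theorem mainTheorem4 {a b ah bh a' b' : Type*}
    [Fintype a] [Fintype b] [Fintype ah] [Fintype bh] [Fintype a'] [Fintype b']
    [DecidableEq a] [DecidableEq b] [DecidableEq ah] [DecidableEq bh]
    [DecidableEq a'] [DecidableEq b']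
    (N : Matrix (a × b) (a × b) ℂ →ₗ[ℂ] Matrix (a' × b') (a' × b') ℂ)
    (ρ : Matrix (ah × bh) (ah × bh) ℂ)
    (hN : QSim.IsChannel N) (hρ : QSim.IsState ρ) :
    -- the simulation error is the value of the primal program
    IsGLB (QSim.simPrimalValues N ρ) (QSim.errPPT N ρ) ∧
    -- the primal program in standard form, and its dual
    (QSim.simSDP N ρ).IsHermitian ∧
    (QSim.simSDP N ρ).primalValues = QSim.simPrimalValues N ρ ∧
    (QSim.simSDP N ρ).dualValues = QSim.simDualValues N ρ :=
  ⟨QSim.isGLB_simPrimalValues hN hρ, QSim.simSDP_isHermitian hN hρ, QSim.simSDP_primalValues,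
    QSim.simSDP_dualValues hρ⟩
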